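/- Let $\gamma>0$ and $0<\alpha<1$. Let $h:(0,\infty)\to\mathbb R$ be a probability density ($h\ge 0$, $\int_0^\infty h(x)\,dx=1$) satisfying $$h(x)=\frac{\gamma}{x}\int_0^x \frac{h(u)}{(x-\alpha u)^{\gamma}}\,du\qquad (x>0).$$ Put $F_j={}_2F_1(\gamma,j\gamma;1+j\gamma;\alpha)$ for $j\ge 0$, where ${}_2F_1$ is the Gauss hypergeometric function, and $$g(x)=\sum_{l=0}^\infty \frac{(-x)^l}{l!}\,\frac{1}{\prod_{j=0}^{l}F_j},$$ and let $J_0$ be the Bessel function of the first kind of order zero. Then, for every $x>0$, $h$ is given by the Hankel transform of order zero of $g$, $$h(x)=\gamma^2x^{-\gamma-1}\int_0^\infty t^{-\gamma-1}J_0\!\left(2[xt]^{-\gamma/2}\right)g(t^{-\gamma})\,dt,$$ and, for every $t>0$, the inversion of this Hankel transform is $$g(t^{-\gamma})=\int_0^\infty J_0\!\left(2[tx]^{-\gamma/2}\right)h(x)\,dx,$$ where both integrals converge absolutely. -/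

import Mathlib

open MeasureTheory Set

/-- The Bessel function of the first kind of order zero (its everywhere convergent power series):
`J₀(z) = ∑ₖ (-1)ᵏ (z/2)²ᵏ / (k!)²`. -/
noncomputable def besselJZero (z : ℝ) : ℝ :=
  ∑' k : ℕ, (-1) ^ k * (z / 2) ^ (2 * k) / (k.factorial : ℝ) ^ 2

/-- The factor `F_j = ₂F₁(γ, jγ; 1 + jγ; α)`. -/
noncomputable def sunFactor (γ α : ℝ) (j : ℕ) : ℝ :=
  ordinaryHypergeometric γ (j * γ) (1 + j * γ) α

/-- The generating function `g(x) = ∑ₗ ((-x)ˡ / l!) · 1 / (F_0 F_1 ⋯ F_l)`. -/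
noncomputable def sunGen (γ α x : ℝ) : ℝ :=
  ∑' l : ℕ, (-x) ^ l / (l.factorial : ℝ) * (1 / ∏ j ∈ Finset.range (l + 1), sunFactor γ α j)

/-- `h` is a (normalised) probability density on `(0, ∞)` that solves the integral equation
`h(x) = (γ / x) ∫₀ˣ h(u) (x - α u)^(-γ) du` for all `x > 0`. -/
structure IsSunDensity (γ α : ℝ) (h : ℝ → ℝ) : Prop where
  nonneg : ∀ x, 0 < x → 0 ≤ h x
  integrable : IntegrableOn h (Ioi 0)
  integral_eq_one : ∫ x in Ioi (0 : ℝ), h x = 1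
  equation : ∀ x, 0 < x → h x = γ / x * ∫ u in (0 : ℝ)..x, h u / (x - α * u) ^ γ

/-!
Put `v = x^{-γ}`, `y = t^{-γ}` and `j(s) = J₀(2√s)` (`besselSq`). If `X` has density `h`, then
`V = X^{-γ}` has a density `k` (`invDensity`), and the integral equation becomes
`k(v) = ∫_v^∞ k(w) φ(v/w) dw` with `φ(q) = (1 - α q^{1/γ})^{-γ}` on `[0, 1]`. In these variables the
two formulas say that `k` and `g` are Hankel transforms of each other:
`g(y) = ∫₀^∞ j(yv) k(v) dv` and `k(v) = ∫₀^∞ j(vy) g(y) dy`.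

*From `k` to `g`.* Tonelli gives `∫ v^l k = (∫₀¹ q^l φ(q) dq) ∫ v^{l+1} k`, and Euler's integral for
`₂F₁` identifies `(l + 1) ∫₀¹ q^l φ(q) dq` with `F_{l+1}`. Hence `∫ v^l k = l! / (F_0 ⋯ F_l)`, and
integrating the power series of `j` against `k` yields `g` (`IsInvSunDensity.sunGen_eq_integral`).

*From `g` to `k`.* By Fubini and Weber's second exponential integral, the damped transform
`∫ e^{-εy} j(vy) g(y) dy` is the mean of `k` against the Weber kernel
`ε⁻¹ e^{-(v+w)/ε} I₀(2√(vw)/ε)`, a Poisson mixture of Gamma densities in `w` with variance of order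
`ε` about `v` (`integral_exp_mul_besselSq_mul_besselSq`, `weberKernel_central_moment`). The integral
equation and `α < 1` show that `k` is bounded and continuous, so these means tend to `k(v)` as
`ε → 0`. The left side tends to the undamped integral by dominated convergence, because `|j| ≤ 1` on
`[0, ∞)` and `g` is integrable.

*Integrability of `g`.* An integration by parts in the moments turns the recursion for the
coefficients into the functional equation `φ(1) g'(y) + g(y) = ∫₀¹ q φ'(q) g'(qy) dq`
(`sunGen_pantograph`). On `L²(y^w dy)` the averaging operator on the right has norm at most
`∫₀¹ q^{(1-w)/2} φ'(q) dq`, which equals `φ(1) - 1` at `w = 1` and so is less than `φ(1)` for some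
`w > 1`. Energy estimates then bound `∫ y^w g²`, and `g ∈ L¹` follows by Cauchy–Schwarz
(`integrableOn_of_pantograph`). No asymptotics of Bessel functions are needed.
-/

/-! ### Alternating exponential series with bounded coefficients -/

/-- The entire function `y ↦ ∑ₙ aₙ (-y)ⁿ / n!` attached to a coefficient sequence `a`. -/
noncomputable def altExp (a : ℕ → ℝ) (y : ℝ) : ℝ :=
  ∑' n : ℕ, (-y) ^ n / (n.factorial : ℝ) * a n

theorem altExp_norm_term_le {a : ℕ → ℝ} (ha : ∀ n, |a n| ≤ 1) {y R : ℝ} (hy : |y| ≤ R) (n : ℕ) :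
    ‖(-y) ^ n / (n.factorial : ℝ) * a n‖ ≤ R ^ n / (n.factorial : ℝ) := by
  rw [norm_mul, norm_div, norm_pow, norm_neg, Real.norm_eq_abs, Real.norm_eq_abs, Real.norm_eq_abs,
    abs_of_nonneg (Nat.cast_nonneg _ : (0 : ℝ) ≤ (n.factorial : ℝ))]
  calc |y| ^ n / (n.factorial : ℝ) * |a n| ≤ |y| ^ n / (n.factorial : ℝ) * 1 := by
        gcongr; exact ha n
    _ ≤ R ^ n / (n.factorial : ℝ) := by rw [mul_one]; gcongr

theorem altExp_hasSum {a : ℕ → ℝ} (ha : ∀ n, |a n| ≤ 1) (y : ℝ) :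
    HasSum (fun n : ℕ => (-y) ^ n / (n.factorial : ℝ) * a n) (altExp a y) :=
  (Summable.of_norm_bounded (Real.summable_pow_div_factorial |y|)
    (altExp_norm_term_le ha le_rfl)).hasSum

theorem altExp_zero (a : ℕ → ℝ) : altExp a 0 = a 0 := by
  rw [altExp, tsum_eq_single 0]
  · simp
  · intro n hn; simp [hn]

theorem altExp_hasDerivAt {a : ℕ → ℝ} (ha : ∀ n, |a n| ≤ 1) (y : ℝ) :
    HasDerivAt (altExp a) (-altExp (fun n => a (n + 1)) y) y := by
  set R := |y| + 1 with hR
  set f' : ℕ → ℝ → ℝ := fun n x =>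
    ((n : ℝ) * (-x) ^ (n - 1) * (-1)) / (n.factorial : ℝ) * a n with hf'
  set u : ℕ → ℝ := fun n => Nat.casesOn n 0 (fun m => R ^ m / (m.factorial : ℝ)) with hu
  have key : ∀ (n : ℕ) (x : ℝ), f' (n + 1) x = -((-x) ^ n / (n.factorial : ℝ) * a (n + 1)) := by
    intro n x
    simp only [hf', Nat.factorial_succ, Nat.add_sub_cancel]
    push_cast
    field_simp
  have hus : Summable u := (summable_nat_add_iff 1).1 (Real.summable_pow_div_factorial R)
  have hd := hasDerivAt_tsum_of_isPreconnected (t := Metric.ball (0 : ℝ) R) (y₀ := 0) (y := y)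
    (g := fun (n : ℕ) (x : ℝ) => (-x) ^ n / (n.factorial : ℝ) * a n) (g' := f') hus
    Metric.isOpen_ball (convex_ball _ _).isPreconnected
    (fun n x _ => by
      have := (((hasDerivAt_id x).neg.pow n).div_const (n.factorial : ℝ)).mul_const (a n)
      simpa [hf'] using this)
    (fun n x hx => by
      cases n with
      | zero => simp [hf', hu]
      | succ m =>
        rw [key, norm_neg]
        exact altExp_norm_term_le (a := fun n => a (n + 1)) (fun n => ha (n + 1))
          (by simpa using (mem_ball_zero_iff.1 hx).le) m)
    (by simp [hR]; positivity) (altExp_hasSum ha 0).summable (by simp [hR])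
  have hs : HasSum (fun n => f' n y) (-altExp (fun n => a (n + 1)) y) := by
    refine (hasSum_nat_add_iff' 1).1 ?_
    simp only [key, Finset.range_one, Finset.sum_singleton]
    have h0 : f' 0 y = 0 := by simp [hf']
    rw [h0, sub_zero]
    exact (altExp_hasSum (a := fun n => a (n + 1)) (fun n => ha (n + 1)) y).neg
  rw [hs.tsum_eq] at hd
  exact hd

theorem altExp_continuous {a : ℕ → ℝ} (ha : ∀ n, |a n| ≤ 1) : Continuous (altExp a) :=
  continuous_iff_continuousAt.2 fun y => (altExp_hasDerivAt ha y).continuousAt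

/-! ### The Bessel function in the squared variable -/

/-- `besselSq s = J₀(2√s)`, as the entire function `∑ₙ (-s)ⁿ / (n!)²`. -/
noncomputable def besselSq (s : ℝ) : ℝ := altExp (fun n => 1 / (n.factorial : ℝ)) s

theorem abs_one_div_factorial_le (n : ℕ) : |1 / (n.factorial : ℝ)| ≤ 1 := by
  rw [abs_of_nonneg (by positivity)]
  exact div_le_one_of_le₀ (by exact_mod_cast Nat.one_le_iff_ne_zero.2 n.factorial_ne_zero)
    (by positivity)

theorem besselJZero_two_mul (r : ℝ) : besselJZero (2 * r) = besselSq (r ^ 2) := by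
  unfold besselJZero besselSq altExp
  refine tsum_congr fun n => ?_
  rw [mul_div_cancel_left₀ _ (two_ne_zero' ℝ), neg_pow (r ^ 2) n, ← pow_mul]
  field_simp

theorem besselSq_continuous : Continuous besselSq := altExp_continuous abs_one_div_factorial_le

theorem besselSq_hasSum (s : ℝ) :
    HasSum (fun n : ℕ => (-s) ^ n / (n.factorial : ℝ) ^ 2) (besselSq s) := by
  have h := altExp_hasSum abs_one_div_factorial_le s
  have he : (fun n : ℕ => (-s) ^ n / (n.factorial : ℝ) * (1 / (n.factorial : ℝ))) =
      fun n : ℕ => (-s) ^ n / (n.factorial : ℝ) ^ 2 := by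
    funext n; field_simp
  rw [he] at h
  exact h

theorem besselSq_zero : besselSq 0 = 1 := by simp [besselSq, altExp_zero]

/-- The Bessel equation `s j'' + j' + j = 0` for `j(s) = J₀(2√s)`. -/
theorem besselSq_ode (s : ℝ) :
    s * altExp (fun n => 1 / ((n + 1 + 1).factorial : ℝ)) s
      - altExp (fun n => 1 / ((n + 1).factorial : ℝ)) s + besselSq s = 0 := by
  have h0 := altExp_hasSum abs_one_div_factorial_le s
  have h1 := altExp_hasSum (a := fun n => 1 / ((n + 1).factorial : ℝ))
    (fun n => abs_one_div_factorial_le (n + 1)) s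
  have h2 := (altExp_hasSum (a := fun n => 1 / ((n + 1 + 1).factorial : ℝ))
    (fun n => abs_one_div_factorial_le (n + 1 + 1)) s).mul_left s
  have h3 : HasSum (fun n : ℕ => -((-s) ^ n / (n.factorial : ℝ) *
      ((n : ℝ) * (1 / ((n + 1).factorial : ℝ)))))
      (s * altExp (fun n => 1 / ((n + 1 + 1).factorial : ℝ)) s) := by
    refine (hasSum_nat_add_iff' 1).1 ?_
    have he : (fun n : ℕ => -((-s) ^ (n + 1) / ((n + 1).factorial : ℝ) *
        (((n + 1 : ℕ) : ℝ) * (1 / ((n + 1 + 1).factorial : ℝ))))) =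
        fun n : ℕ => s * ((-s) ^ n / (n.factorial : ℝ) * (1 / ((n + 1 + 1).factorial : ℝ))) := by
      funext n
      have : (n.factorial : ℝ) ≠ 0 := by positivity
      have : ((n + 1 + 1).factorial : ℝ) ≠ 0 := by positivity
      rw [Nat.factorial_succ n]
      push_cast
      field_simp
      ring
    rw [he]
    simpa using h2
  have he : ∀ n : ℕ, -((-s) ^ n / (n.factorial : ℝ) * ((n : ℝ) * (1 / ((n + 1).factorial : ℝ)))) -
      (-s) ^ n / (n.factorial : ℝ) * (1 / ((n + 1).factorial : ℝ)) +
      (-s) ^ n / (n.factorial : ℝ) * (1 / (n.factorial : ℝ)) = 0 := by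
    intro n
    rw [Nat.factorial_succ n]
    push_cast
    field_simp
    ring
  have h4 := (h3.sub h1).add h0
  simp only [he] at h4
  exact h4.unique hasSum_zero

/-- The energy `j² + s j'²` is nonincreasing for `s ≥ 0`, by the Bessel equation, and equals `1`
at the origin. -/
theorem abs_besselSq_le_one {s : ℝ} (hs : 0 ≤ s) : |besselSq s| ≤ 1 := by
  set b1 := altExp (fun n => 1 / ((n + 1).factorial : ℝ)) with hb1
  set b2 := altExp (fun n => 1 / ((n + 1 + 1).factorial : ℝ)) with hb2
  have d0 : ∀ x, HasDerivAt besselSq (-b1 x) x := fun x =>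
    altExp_hasDerivAt abs_one_div_factorial_le x
  have d1 : ∀ x, HasDerivAt b1 (-b2 x) x := fun x =>
    altExp_hasDerivAt (a := fun n => 1 / ((n + 1).factorial : ℝ))
      (fun n => abs_one_div_factorial_le (n + 1)) x
  have dE : ∀ x, HasDerivAt (fun x => besselSq x ^ 2 + x * b1 x ^ 2) (-b1 x ^ 2) x := by
    intro x
    refine (((d0 x).pow 2).add ((hasDerivAt_id x).mul ((d1 x).pow 2))).congr_deriv ?_
    have := besselSq_ode x
    rw [← hb1, ← hb2] at this
    simp only [Pi.pow_apply, id_eq]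
    push_cast
    linear_combination (-2 * b1 x) * this
  have hanti : AntitoneOn (fun x => besselSq x ^ 2 + x * b1 x ^ 2) (Ici 0) :=
    antitoneOn_of_deriv_nonpos (convex_Ici 0)
      (fun x _ => (dE x).continuousAt.continuousWithinAt)
      (fun x _ => (dE x).differentiableAt.differentiableWithinAt)
      (fun x _ => by rw [(dE x).deriv]; nlinarith [sq_nonneg (b1 x)])
  have := hanti (mem_Ici.2 le_rfl) (mem_Ici.2 hs) hs
  simp only [besselSq_zero] at this
  rw [← sq_le_one_iff_abs_le_one]
  nlinarith [mul_nonneg hs (sq_nonneg (b1 s))]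

/-! ### Weber's second exponential integral -/

theorem hasSum_pow_mul_choose_div_factorial (x : ℝ) (k : ℕ) :
    HasSum (fun n : ℕ => x ^ n / (n.factorial : ℝ) * (n.choose k : ℝ))
      (x ^ k / (k.factorial : ℝ) * Real.exp x) := by
  refine (hasSum_nat_add_iff' k).1 ?_
  rw [Finset.sum_eq_zero, sub_zero]
  · have h := (NormedSpace.expSeries_div_hasSum_exp (𝔸 := ℝ) x).mul_left
      (x ^ k / (k.factorial : ℝ))
    rw [← Real.exp_eq_exp_ℝ] at h
    have he : (fun n : ℕ => x ^ k / (k.factorial : ℝ) * (x ^ n / (n.factorial : ℝ))) =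
        fun n : ℕ => x ^ (n + k) / ((n + k).factorial : ℝ) * ((n + k).choose k : ℝ) := by
      funext n
      rw [Nat.add_comm n k, Nat.cast_add_choose, pow_add]
      field_simp
    rw [he] at h
    exact h
  · intro n hn
    rw [Nat.choose_eq_zero_of_lt (Finset.mem_range.1 hn)]
    simp

theorem cast_add_choose_eq_sum (n m : ℕ) :
    HasSum (fun k : ℕ => (n.choose k : ℝ) * (m.choose k : ℝ)) ((n + m).choose n : ℝ) := by
  have h : ((n + m).choose n : ℝ) =
      ∑ k ∈ Finset.range (n + 1), (n.choose k : ℝ) * (m.choose k : ℝ) := by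
    rw [Nat.add_comm n m, Nat.add_choose_eq, Finset.Nat.sum_antidiagonal_eq_sum_range_succ_mk]
    push_cast
    refine Finset.sum_congr rfl fun k hk => ?_
    rw [Nat.choose_symm (Nat.lt_succ_iff.1 (Finset.mem_range.1 hk)), mul_comm]
  rw [h]
  refine hasSum_sum_of_ne_finset_zero fun k hk => ?_
  rw [Nat.choose_eq_zero_of_lt (by simpa using hk)]
  simp

theorem summable_pow_mul_pow_mul_choose {a b : ℝ} (ha : 0 ≤ a) (hb : 0 ≤ b) :
    Summable (fun p : ℕ × ℕ => a ^ p.1 / (p.1.factorial : ℝ) * (b ^ p.2 / (p.2.factorial : ℝ)) *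
      ((p.1 + p.2).choose p.1 : ℝ)) := by
  refine Summable.of_nonneg_of_le (fun p => by positivity) (fun p => ?_)
    ((Real.summable_pow_div_factorial (2 * a)).mul_of_nonneg
      (Real.summable_pow_div_factorial (2 * b)) (fun n => by positivity) (fun n => by positivity))
  have h : ((p.1 + p.2).choose p.1 : ℝ) ≤ 2 ^ (p.1 + p.2) := by
    exact_mod_cast Nat.choose_le_two_pow _ _
  calc _ ≤ a ^ p.1 / (p.1.factorial : ℝ) * (b ^ p.2 / (p.2.factorial : ℝ)) * 2 ^ (p.1 + p.2) := by
        gcongr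
    _ = _ := by rw [mul_pow, mul_pow, pow_add]; ring

/-- The identity
`∑ₙₘ (-a)ⁿ (-b)ᵐ (n+m)! / (n! m!)² = e^{-a-b} ∑ₖ (ab)ᵏ / (k!)²`, from Vandermonde's convolution
`(n+m choose n) = ∑ₖ (n choose k)(m choose k)`. -/
theorem hasSum_alternating_choose {a b : ℝ} (ha : 0 ≤ a) (hb : 0 ≤ b) :
    HasSum (fun p : ℕ × ℕ => (-a) ^ p.1 / (p.1.factorial : ℝ) *
      ((-b) ^ p.2 / (p.2.factorial : ℝ)) * ((p.1 + p.2).choose p.1 : ℝ))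
      (∑' k : ℕ, (a ^ k / (k.factorial : ℝ) * Real.exp (-a)) *
        (b ^ k / (k.factorial : ℝ) * Real.exp (-b))) := by
  set f : (ℕ × ℕ) × ℕ → ℝ := fun q => (-a) ^ q.1.1 / (q.1.1.factorial : ℝ) *
      ((-b) ^ q.1.2 / (q.1.2.factorial : ℝ)) * ((q.1.1.choose q.2 : ℝ) * (q.1.2.choose q.2 : ℝ))
    with hf
  have hnorm : ∀ q, ‖f q‖ = a ^ q.1.1 / (q.1.1.factorial : ℝ) *
      (b ^ q.1.2 / (q.1.2.factorial : ℝ)) *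
        ((q.1.1.choose q.2 : ℝ) * (q.1.2.choose q.2 : ℝ)) := by
    intro q
    simp [hf, abs_of_nonneg ha, abs_of_nonneg hb]
  have hfib : ∀ p : ℕ × ℕ, HasSum (fun k => ‖f (p, k)‖) (a ^ p.1 / (p.1.factorial : ℝ) *
      (b ^ p.2 / (p.2.factorial : ℝ)) * ((p.1 + p.2).choose p.1 : ℝ)) := by
    intro p
    simp only [hnorm]
    exact (cast_add_choose_eq_sum p.1 p.2).mul_left _
  have hsum : Summable f := by
    refine Summable.of_norm ((summable_prod_of_nonneg fun q => norm_nonneg _).2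
      ⟨fun p => (hfib p).summable, ?_⟩)
    simp only [(hfib _).tsum_eq]
    exact summable_pow_mul_pow_mul_choose ha hb
  have h1 : HasSum (fun p : ℕ × ℕ => (-a) ^ p.1 / (p.1.factorial : ℝ) *
      ((-b) ^ p.2 / (p.2.factorial : ℝ)) * ((p.1 + p.2).choose p.1 : ℝ)) (∑' q, f q) :=
    hsum.hasSum.prod_fiberwise fun p => (cast_add_choose_eq_sum p.1 p.2).mul_left _
  have h2 : ∑' q, f q = ∑' k : ℕ, (a ^ k / (k.factorial : ℝ) * Real.exp (-a)) *
        (b ^ k / (k.factorial : ℝ) * Real.exp (-b)) := by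
    have hs : Summable (fun q : ℕ × (ℕ × ℕ) => f (q.2, q.1)) :=
      (Equiv.prodComm ℕ (ℕ × ℕ)).summable_iff.2 hsum
    rw [← (Equiv.prodComm ℕ (ℕ × ℕ)).tsum_eq f]
    change ∑' q : ℕ × (ℕ × ℕ), f (q.2, q.1) = _
    rw [hs.tsum_prod]
    refine tsum_congr fun k => ?_
    have e1 := hasSum_pow_mul_choose_div_factorial (-a) k
    have e2 := hasSum_pow_mul_choose_div_factorial (-b) k
    have e3 := e1.mul e2 (summable_mul_of_summable_norm e1.summable.norm e2.summable.norm)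
    have e4 : (-a) ^ k / (k.factorial : ℝ) * Real.exp (-a) *
        ((-b) ^ k / (k.factorial : ℝ) * Real.exp (-b)) =
        (a ^ k / (k.factorial : ℝ) * Real.exp (-a)) *
        (b ^ k / (k.factorial : ℝ) * Real.exp (-b)) := by
      rw [neg_pow a, neg_pow b]
      have : ((-1 : ℝ) ^ k) * (-1) ^ k = 1 := by rw [← mul_pow]; simp
      linear_combination (a ^ k / (k.factorial : ℝ) * Real.exp (-a)) *
        (b ^ k / (k.factorial : ℝ) * Real.exp (-b)) * this
    rw [← e4, ← e3.tsum_eq]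
    refine tsum_congr fun p => ?_
    simp only [hf]
    ring
  rw [← h2]
  exact h1

/-- The Weber kernel `ε⁻¹ e^{-(v+w)/ε} I₀(2√(vw)/ε)`, written as a Poisson mixture (with mean
`v/ε`) of Gamma densities in `w`. -/
noncomputable def weberKernel (ε v w : ℝ) : ℝ :=
  ∑' n : ℕ, ((v / ε) ^ n / (n.factorial : ℝ) * Real.exp (-(v / ε))) *
    ((w / ε) ^ n / (n.factorial : ℝ) * Real.exp (-(w / ε)) / ε)

theorem integral_pow_mul_exp_neg_mul (n : ℕ) {ε : ℝ} (hε : 0 < ε) :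
    IntegrableOn (fun y : ℝ => y ^ n * Real.exp (-(ε * y))) (Ioi 0) ∧
    ∫ y in Ioi (0 : ℝ), y ^ n * Real.exp (-(ε * y)) = (n.factorial : ℝ) / ε ^ (n + 1) := by
  have h := Real.integral_rpow_mul_exp_neg_mul_Ioi (a := (n : ℝ) + 1) (r := ε) (by positivity) hε
  have he : ∀ y : ℝ, y ^ ((n : ℝ) + 1 - 1) * Real.exp (-(ε * y)) = y ^ n * Real.exp (-(ε * y)) := by
    intro y; rw [add_sub_cancel_right, Real.rpow_natCast]
  simp only [he] at h
  have h' : ∫ y in Ioi (0 : ℝ), y ^ n * Real.exp (-(ε * y)) = (n.factorial : ℝ) / ε ^ (n + 1) := by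
    rw [h, Real.Gamma_nat_eq_factorial, one_div, Real.inv_rpow hε.le,
      show (n : ℝ) + 1 = ((n + 1 : ℕ) : ℝ) by push_cast; ring, Real.rpow_natCast]
    field_simp
  refine ⟨?_, h'⟩
  -- a non-integrable function would have integral `0`
  by_contra hni
  have := integral_undef hni
  rw [h'] at this
  have : (0 : ℝ) < (n.factorial : ℝ) / ε ^ (n + 1) := by positivity
  linarith

theorem besselSq_mul_besselSq_hasSum (s t : ℝ) :
    HasSum (fun p : ℕ × ℕ => (-s) ^ p.1 / (p.1.factorial : ℝ) ^ 2 *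
      ((-t) ^ p.2 / (p.2.factorial : ℝ) ^ 2)) (besselSq s * besselSq t) := by
  have h : Summable (fun p : ℕ × ℕ => (-s) ^ p.1 / (p.1.factorial : ℝ) ^ 2 *
      ((-t) ^ p.2 / (p.2.factorial : ℝ) ^ 2)) :=
    summable_mul_of_summable_norm (f := fun n : ℕ => (-s) ^ n / (n.factorial : ℝ) ^ 2)
      (g := fun n : ℕ => (-t) ^ n / (n.factorial : ℝ) ^ 2)
      (besselSq_hasSum s).summable.norm (besselSq_hasSum t).summable.norm
  exact (besselSq_hasSum s).mul (besselSq_hasSum t) h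

/-- Weber's second exponential integral:
`∫₀^∞ e^{-εy} J₀(2√(vy)) J₀(2√(wy)) dy = ε⁻¹ e^{-(v+w)/ε} I₀(2√(vw)/ε)`. -/
theorem integral_exp_mul_besselSq_mul_besselSq {ε v w : ℝ} (hε : 0 < ε) (hv : 0 ≤ v) (hw : 0 ≤ w) :
    ∫ y in Ioi (0 : ℝ), Real.exp (-(ε * y)) * besselSq (v * y) * besselSq (w * y) =
      weberKernel ε v w := by
  set F : ℕ × ℕ → ℝ → ℝ := fun p y => ((-v) ^ p.1 / (p.1.factorial : ℝ) ^ 2 *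
    ((-w) ^ p.2 / (p.2.factorial : ℝ) ^ 2)) * (y ^ (p.1 + p.2) * Real.exp (-(ε * y))) with hF
  have hint : ∀ p, IntegrableOn (F p) (Ioi 0) := fun p =>
    (integral_pow_mul_exp_neg_mul (p.1 + p.2) hε).1.const_mul _
  have hfac : ∀ n m : ℕ, (((n + m).choose n : ℕ) : ℝ) =
      ((n + m).factorial : ℝ) / ((n.factorial : ℝ) * (m.factorial : ℝ)) := fun n m => by
    rw [Nat.cast_add_choose]
  have hval : ∀ p, ∫ y in Ioi (0 : ℝ), F p y = ε⁻¹ * ((-(v / ε)) ^ p.1 / (p.1.factorial : ℝ) *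
      ((-(w / ε)) ^ p.2 / (p.2.factorial : ℝ)) * ((p.1 + p.2).choose p.1 : ℝ)) := by
    intro p
    rw [hF]
    simp only []
    rw [integral_const_mul, (integral_pow_mul_exp_neg_mul (p.1 + p.2) hε).2, hfac,
      ← neg_div, ← neg_div, div_pow, div_pow]
    field_simp
    ring
  have hnval : ∀ p, ∫ y in Ioi (0 : ℝ), ‖F p y‖ = ε⁻¹ * ((v / ε) ^ p.1 / (p.1.factorial : ℝ) *
      ((w / ε) ^ p.2 / (p.2.factorial : ℝ)) * ((p.1 + p.2).choose p.1 : ℝ)) := by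
    intro p
    have : ∀ y ∈ Ioi (0 : ℝ), ‖F p y‖ = (v ^ p.1 / (p.1.factorial : ℝ) ^ 2 *
        (w ^ p.2 / (p.2.factorial : ℝ) ^ 2)) * (y ^ (p.1 + p.2) * Real.exp (-(ε * y))) := by
      intro y hy
      have hy' : (0 : ℝ) < y := hy
      simp [hF, abs_of_nonneg hv, abs_of_nonneg hw, abs_of_pos hy']
    rw [setIntegral_congr_fun measurableSet_Ioi this, integral_const_mul,
      (integral_pow_mul_exp_neg_mul (p.1 + p.2) hε).2, hfac, div_pow, div_pow]
    field_simp
    ring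
  have hS := hasSum_integral_of_summable_integral_norm hint (by
    simp only [hnval]
    exact (summable_pow_mul_pow_mul_choose (div_nonneg hv hε.le)
      (div_nonneg hw hε.le)).mul_left ε⁻¹)
  simp only [hval] at hS
  have hS' := (hasSum_alternating_choose (div_nonneg hv hε.le) (div_nonneg hw hε.le)).mul_left ε⁻¹
  have hpt : ∀ y ∈ Ioi (0 : ℝ), ∑' p, F p y =
      Real.exp (-(ε * y)) * besselSq (v * y) * besselSq (w * y) := by
    intro y hy
    rw [mul_assoc, ← (besselSq_mul_besselSq_hasSum (v * y) (w * y)).tsum_eq, ← tsum_mul_left]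
    refine tsum_congr fun p => ?_
    rw [← neg_mul v, ← neg_mul w, mul_pow, mul_pow]
    change _ * (y ^ (p.1 + p.2) * _) = _
    rw [pow_add]
    ring
  calc ∫ y in Ioi (0 : ℝ), Real.exp (-(ε * y)) * besselSq (v * y) * besselSq (w * y)
      = ∫ y in Ioi (0 : ℝ), ∑' p, F p y := (setIntegral_congr_fun measurableSet_Ioi hpt).symm
    _ = ε⁻¹ * ∑' k : ℕ, ((v / ε) ^ k / (k.factorial : ℝ) * Real.exp (-(v / ε))) *
        ((w / ε) ^ k / (k.factorial : ℝ) * Real.exp (-(w / ε))) := hS.unique hS'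
    _ = weberKernel ε v w := by
      rw [weberKernel, ← tsum_mul_left]
      refine tsum_congr fun n => ?_
      ring

/-! ### The Weber kernel is an approximate identity -/

theorem weberKernel_nonneg {ε v w : ℝ} (hε : 0 < ε) (hv : 0 ≤ v) (hw : 0 ≤ w) :
    0 ≤ weberKernel ε v w :=
  tsum_nonneg fun n => by positivity

/-- The `j`-th moment of the Weber kernel, in terms of factorial moments `m` of the Poisson law. -/
theorem weberKernel_moment {ε v : ℝ} (hε : 0 < ε) (hv : 0 ≤ v) (j : ℕ) {m : ℝ} (hm0 : 0 < m)
    (hm : HasSum (fun n : ℕ => (v / ε) ^ n / (n.factorial : ℝ) * Real.exp (-(v / ε)) *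
      (((n + j).factorial : ℝ) / (n.factorial : ℝ))) m) :
    IntegrableOn (fun w => w ^ j * weberKernel ε v w) (Ioi 0) ∧
      ∫ w in Ioi (0 : ℝ), w ^ j * weberKernel ε v w = ε ^ j * m := by
  set p : ℕ → ℝ := fun n => (v / ε) ^ n / (n.factorial : ℝ) * Real.exp (-(v / ε)) with hp
  have hp0 : ∀ n, 0 ≤ p n := fun n => by positivity
  set F : ℕ → ℝ → ℝ := fun n w => p n / (ε ^ (n + 1) * (n.factorial : ℝ)) *
    (w ^ (n + j) * Real.exp (-(ε⁻¹ * w))) with hF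
  have hε' : 0 < ε⁻¹ := inv_pos.2 hε
  have hint : ∀ n, IntegrableOn (F n) (Ioi 0) := fun n =>
    (integral_pow_mul_exp_neg_mul (n + j) hε').1.const_mul _
  have hval : ∀ n, ∫ w in Ioi (0 : ℝ), F n w =
      ε ^ j * (p n * (((n + j).factorial : ℝ) / (n.factorial : ℝ))) := by
    intro n
    change ∫ w in Ioi (0 : ℝ), _ * _ = _
    rw [integral_const_mul, (integral_pow_mul_exp_neg_mul (n + j) hε').2, inv_pow,
      show n + j + 1 = n + 1 + j by ring, pow_add ε (n + 1) j]
    field_simp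
  have hnorm : ∀ n, ∫ w in Ioi (0 : ℝ), ‖F n w‖ = ∫ w in Ioi (0 : ℝ), F n w := by
    intro n
    refine setIntegral_congr_fun measurableSet_Ioi fun w hw => ?_
    have hw' : (0 : ℝ) < w := hw
    have := hp0 n
    exact Real.norm_of_nonneg (by positivity)
  have hS := hasSum_integral_of_summable_integral_norm hint (by
    simp only [hnorm, hval]
    exact (hm.summable).mul_left (ε ^ j))
  simp only [hval] at hS
  have hpt : ∀ w : ℝ, ∑' n, F n w = w ^ j * weberKernel ε v w := by
    intro w
    rw [weberKernel, ← tsum_mul_left]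
    refine tsum_congr fun n => ?_
    change p n / (ε ^ (n + 1) * (n.factorial : ℝ)) * (w ^ (n + j) * Real.exp (-(ε⁻¹ * w))) =
      w ^ j * (p n * ((w / ε) ^ n / (n.factorial : ℝ) * Real.exp (-(w / ε)) / ε))
    rw [div_pow, div_eq_inv_mul w ε]
    field_simp
    ring
  simp only [hpt] at hS
  have hv' : ∫ w in Ioi (0 : ℝ), w ^ j * weberKernel ε v w = ε ^ j * m :=
    hS.unique (hm.mul_left (ε ^ j))
  refine ⟨?_, hv'⟩
  -- a non-integrable function would have integral `0`
  by_contra hni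
  have h0 := integral_undef hni
  rw [hv'] at h0
  have : 0 < ε ^ j * m := by positivity
  linarith

/-- Binomial moments of the Poisson law of mean `l`. -/
theorem poisson_hasSum_choose (l : ℝ) (k : ℕ) :
    HasSum (fun n : ℕ => l ^ n / (n.factorial : ℝ) * Real.exp (-l) * (n.choose k : ℝ))
      (l ^ k / (k.factorial : ℝ)) := by
  have h := (hasSum_pow_mul_choose_div_factorial l k).mul_right (Real.exp (-l))
  rw [mul_assoc, ← Real.exp_add, add_neg_cancel, Real.exp_zero, mul_one] at h
  have he : (fun n : ℕ => l ^ n / (n.factorial : ℝ) * (n.choose k : ℝ) * Real.exp (-l)) =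
      fun n : ℕ => l ^ n / (n.factorial : ℝ) * Real.exp (-l) * (n.choose k : ℝ) := by
    funext n; ring
  rwa [he] at h

theorem weberKernel_moment_zero {ε v : ℝ} (hε : 0 < ε) (hv : 0 ≤ v) :
    IntegrableOn (weberKernel ε v) (Ioi 0) ∧ ∫ w in Ioi (0 : ℝ), weberKernel ε v w = 1 := by
  have h := weberKernel_moment hε hv 0 one_pos (by
    have := poisson_hasSum_choose (v / ε) 0
    simp only [Nat.choose_zero_right, Nat.cast_one, mul_one, pow_zero, Nat.factorial_zero,
      div_one] at this
    have he : ∀ n : ℕ, ((n + 0).factorial : ℝ) / (n.factorial : ℝ) = 1 := fun n =>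
      div_self (by positivity)
    simpa only [he, mul_one] using this)
  simpa using h

theorem weberKernel_moment_one {ε v : ℝ} (hε : 0 < ε) (hv : 0 ≤ v) :
    IntegrableOn (fun w => w * weberKernel ε v w) (Ioi 0) ∧
      ∫ w in Ioi (0 : ℝ), w * weberKernel ε v w = ε * (v / ε + 1) := by
  have h := weberKernel_moment (m := v / ε + 1) hε hv 1 (by positivity) (by
    have := (poisson_hasSum_choose (v / ε) 1).add (poisson_hasSum_choose (v / ε) 0)
    simp only [Nat.choose_zero_right, Nat.choose_one_right, Nat.cast_one, mul_one, pow_zero,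
      Nat.factorial_zero, Nat.factorial_one, div_one, pow_one] at this
    have he : ∀ n : ℕ, (v / ε) ^ n / (n.factorial : ℝ) * Real.exp (-(v / ε)) * n +
        (v / ε) ^ n / (n.factorial : ℝ) * Real.exp (-(v / ε)) =
        (v / ε) ^ n / (n.factorial : ℝ) * Real.exp (-(v / ε)) *
          (((n + 1).factorial : ℝ) / (n.factorial : ℝ)) := fun n => by
      rw [Nat.factorial_succ]; push_cast; field_simp
    simpa only [he] using this)
  simpa using h

theorem weberKernel_moment_two {ε v : ℝ} (hε : 0 < ε) (hv : 0 ≤ v) :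
    IntegrableOn (fun w => w ^ 2 * weberKernel ε v w) (Ioi 0) ∧
      ∫ w in Ioi (0 : ℝ), w ^ 2 * weberKernel ε v w =
        ε ^ 2 * ((v / ε) ^ 2 + 4 * (v / ε) + 2) := by
  refine weberKernel_moment (m := (v / ε) ^ 2 + 4 * (v / ε) + 2) hε hv 2 (by positivity) ?_
  have := (((poisson_hasSum_choose (v / ε) 2).mul_left 2).add
    ((poisson_hasSum_choose (v / ε) 1).mul_left 4)).add
    ((poisson_hasSum_choose (v / ε) 0).mul_left 2)
  have he : ∀ n : ℕ, 2 * ((v / ε) ^ n / (n.factorial : ℝ) * Real.exp (-(v / ε)) *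
        (n.choose 2 : ℝ)) +
      4 * ((v / ε) ^ n / (n.factorial : ℝ) * Real.exp (-(v / ε)) * (n.choose 1 : ℝ)) +
      2 * ((v / ε) ^ n / (n.factorial : ℝ) * Real.exp (-(v / ε)) * (n.choose 0 : ℝ)) =
      (v / ε) ^ n / (n.factorial : ℝ) * Real.exp (-(v / ε)) *
        (((n + 2).factorial : ℝ) / (n.factorial : ℝ)) := fun n => by
    rw [Nat.factorial_succ, Nat.factorial_succ, Nat.cast_choose_two]
    simp only [Nat.choose_one_right, Nat.choose_zero_right]
    push_cast
    field_simp
    ring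
  simp only [he] at this
  have hm : (v / ε) ^ 2 + 4 * (v / ε) + 2 = 2 * ((v / ε) ^ 2 / (Nat.factorial 2 : ℝ)) +
      4 * ((v / ε) ^ 1 / (Nat.factorial 1 : ℝ)) + 2 * ((v / ε) ^ 0 / (Nat.factorial 0 : ℝ)) := by
    rw [Nat.factorial_two, Nat.factorial_one, Nat.factorial_zero]
    push_cast
    ring
  rw [hm]
  exact this

/-- The variance bound that makes the Weber kernel concentrate at `v` as `ε → 0`. -/
theorem weberKernel_central_moment {ε v : ℝ} (hε : 0 < ε) (hv : 0 ≤ v) :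
    IntegrableOn (fun w => weberKernel ε v w * (w - v) ^ 2) (Ioi 0) ∧
      ∫ w in Ioi (0 : ℝ), weberKernel ε v w * (w - v) ^ 2 = 2 * ε * v + 2 * ε ^ 2 := by
  obtain ⟨i0, e0⟩ := weberKernel_moment_zero hε hv
  obtain ⟨i1, e1⟩ := weberKernel_moment_one hε hv
  obtain ⟨i2, e2⟩ := weberKernel_moment_two hε hv
  have he : (fun w => weberKernel ε v w * (w - v) ^ 2) = fun w =>
      w ^ 2 * weberKernel ε v w - 2 * v * (w * weberKernel ε v w) + v ^ 2 * weberKernel ε v w := by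
    funext w; ring
  rw [he]
  refine ⟨(i2.sub (i1.const_mul _)).add (i0.const_mul _), ?_⟩
  have a1 : ∫ w in Ioi (0 : ℝ), (w ^ 2 * weberKernel ε v w - 2 * v * (w * weberKernel ε v w) +
      v ^ 2 * weberKernel ε v w) = (∫ w in Ioi (0 : ℝ), (w ^ 2 * weberKernel ε v w -
      2 * v * (w * weberKernel ε v w))) + ∫ w in Ioi (0 : ℝ), v ^ 2 * weberKernel ε v w :=
    integral_add (i2.sub (i1.const_mul _)) (i0.const_mul _)
  have a2 : ∫ w in Ioi (0 : ℝ), (w ^ 2 * weberKernel ε v w - 2 * v * (w * weberKernel ε v w)) =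
      (∫ w in Ioi (0 : ℝ), w ^ 2 * weberKernel ε v w) -
      ∫ w in Ioi (0 : ℝ), 2 * v * (w * weberKernel ε v w) :=
    integral_sub i2 (i1.const_mul _)
  rw [a1, a2, integral_const_mul, integral_const_mul, e0, e1, e2]
  field_simp
  ring

theorem tendsto_integral_weberKernel {k : ℝ → ℝ} {M v : ℝ} (hv : 0 < v)
    (hk : ∀ w, 0 < w → |k w| ≤ M) (hmeas : AEStronglyMeasurable k (volume.restrict (Ioi 0)))
    (hc : ContinuousAt k v) :
    Filter.Tendsto (fun ε => ∫ w in Ioi (0 : ℝ), weberKernel ε v w * k w)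
      (nhdsWithin 0 (Ioi 0)) (nhds (k v)) := by
  rw [Metric.tendsto_nhds]
  intro η hη
  obtain ⟨δ, hδ, hδk⟩ := Metric.continuousAt_iff.1 hc (η / 2) (by positivity)
  set C := 2 * M / δ ^ 2 with hC
  have hM : 0 ≤ M := (abs_nonneg _).trans (hk v hv)
  have hsmall : ∀ᶠ ε in nhdsWithin (0 : ℝ) (Ioi 0), C * (2 * ε * v + 2 * ε ^ 2) < η / 2 := by
    have hcont : Continuous fun ε : ℝ => C * (2 * ε * v + 2 * ε ^ 2) := by fun_prop
    have := hcont.tendsto 0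
    simp only [mul_zero, zero_mul, ne_eq, OfNat.ofNat_ne_zero, not_false_eq_true, zero_pow,
      add_zero] at this
    exact (this.mono_left nhdsWithin_le_nhds).eventually (gt_mem_nhds (by positivity))
  filter_upwards [hsmall, self_mem_nhdsWithin] with ε hε1 hε
  have hε : 0 < ε := hε
  obtain ⟨i0, e0⟩ := weberKernel_moment_zero hε hv.le
  obtain ⟨i2, e2⟩ := weberKernel_central_moment hε hv.le
  have ik : IntegrableOn (fun w => weberKernel ε v w * k w) (Ioi 0) :=
    i0.mul_bdd (c := M) hmeas ((ae_restrict_mem measurableSet_Ioi).mono fun w hw => hk w hw)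
  have hdiff : (∫ w in Ioi (0 : ℝ), weberKernel ε v w * k w) - k v =
      ∫ w in Ioi (0 : ℝ), (weberKernel ε v w * k w - weberKernel ε v w * k v) := by
    rw [integral_sub ik (i0.mul_const _), integral_mul_const, e0, one_mul]
  -- Chebyshev: away from `v` the oscillation `2M` is at most `C (w - v)²`
  have hpt : ∀ w ∈ Ioi (0 : ℝ), ‖weberKernel ε v w * k w - weberKernel ε v w * k v‖ ≤
      η / 2 * weberKernel ε v w + C * (weberKernel ε v w * (w - v) ^ 2) := by
    intro w hw
    have hK := weberKernel_nonneg hε hv.le (le_of_lt hw)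
    rw [← mul_sub, norm_mul, Real.norm_of_nonneg hK]
    have hkey : ‖k w - k v‖ ≤ η / 2 + C * (w - v) ^ 2 := by
      by_cases hwv : dist w v < δ
      · have := (hδk hwv).le
        rw [Real.dist_eq] at this
        have h2 : 0 ≤ C * (w - v) ^ 2 := by positivity
        rw [Real.norm_eq_abs]
        linarith
      · have h1 : δ ^ 2 ≤ (w - v) ^ 2 := by
          rw [← sq_abs (w - v)]
          rw [Real.dist_eq, not_lt] at hwv
          gcongr
        have h2 : 2 * M ≤ C * (w - v) ^ 2 := by
          calc 2 * M = C * δ ^ 2 := by rw [hC]; field_simp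
            _ ≤ _ := by gcongr
        have h3 : ‖k w - k v‖ ≤ M + M := (norm_sub_le _ _).trans (add_le_add (hk w hw) (hk v hv))
        linarith
    calc weberKernel ε v w * ‖k w - k v‖ ≤ weberKernel ε v w * (η / 2 + C * (w - v) ^ 2) := by
          gcongr
      _ = _ := by ring
  have hb := norm_integral_le_of_norm_le ((i0.const_mul (η / 2)).add (i2.const_mul C))
    ((ae_restrict_mem measurableSet_Ioi).mono hpt)
  have hI : ∫ w in Ioi (0 : ℝ), (η / 2 * weberKernel ε v w + C * (weberKernel ε v w * (w - v) ^ 2))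
      = η / 2 + C * (2 * ε * v + 2 * ε ^ 2) := by
    rw [integral_add (i0.const_mul (η / 2)) (i2.const_mul C), integral_const_mul,
      integral_const_mul, e0, e2, mul_one]
  rw [Real.dist_eq, hdiff, ← Real.norm_eq_abs]
  simp only [Pi.add_apply] at hb
  rw [hI] at hb
  linarith

/-! ### Integrability of solutions of a pantograph-type equation -/

/-- Cauchy–Schwarz in weighted form: the averaging operator `u ↦ ∫₀¹ m(q) u(qy) dq` has norm at
most `I = ∫₀¹ m(q) q^{-(w+1)/2} dq` on `L²([0,T], y^w dy)`, because dilation by `q` has norm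
`q^{-(w+1)/2}` there. -/
theorem integral_weight_mul_average_le {f u m : ℝ → ℝ} {w I l T : ℝ} (hw : 0 < w) (hl : 0 < l)
    (hT : 0 ≤ T) (hf : Continuous f) (hu : Continuous u) (hm : ContinuousOn m (Icc 0 1))
    (hm0 : ∀ q ∈ Icc (0 : ℝ) 1, 0 ≤ m q)
    (hint : IntervalIntegrable (fun q => m q * q ^ (-((w + 1) / 2))) volume 0 1)
    (hI : ∫ q in (0 : ℝ)..1, m q * q ^ (-((w + 1) / 2)) = I)
    (hR : ContinuousOn (fun y => ∫ q in (0 : ℝ)..1, m q * u (q * y)) (Icc 0 T)) :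
    ∫ y in (0 : ℝ)..T, y ^ w * (f y * ∫ q in (0 : ℝ)..1, m q * u (q * y)) ≤
      l / 2 * I * (∫ y in (0 : ℝ)..T, y ^ w * f y ^ 2) +
      1 / (2 * l) * I * ∫ y in (0 : ℝ)..T, y ^ w * u y ^ 2 := by
  set s := (w + 1) / 2 with hs
  have hs0 : 0 < s := by rw [hs]; linarith
  set A := ∫ y in (0 : ℝ)..T, y ^ w * u y ^ 2 with hA
  have hcw : Continuous fun y : ℝ => y ^ w := Real.continuous_rpow_const hw.le
  have hcs : Continuous fun y : ℝ => y ^ s := Real.continuous_rpow_const hs0.le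
  set J : ℝ → ℝ → ℝ := fun y q => y ^ w * (m q * q ^ s * u (q * y) ^ 2) with hJ
  have hJc : ContinuousOn J.uncurry (Icc 0 T ×ˢ Icc 0 1) := by
    have h1 : ContinuousOn (fun p : ℝ × ℝ => m p.2) (Icc 0 T ×ˢ Icc 0 1) :=
      hm.comp continuous_snd.continuousOn fun p hp => hp.2
    have h2 : Continuous fun p : ℝ × ℝ => p.1 ^ w := hcw.comp continuous_fst
    have h3 : Continuous fun p : ℝ × ℝ => p.2 ^ s := hcs.comp continuous_snd
    have h4 : Continuous fun p : ℝ × ℝ => u (p.2 * p.1) ^ 2 := by fun_prop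
    exact h2.continuousOn.mul ((h1.mul h3.continuousOn).mul h4.continuousOn)
  have hJi : IntegrableOn J.uncurry (uIoc 0 T ×ˢ uIoc 0 1) := by
    rw [uIoc_of_le hT, uIoc_of_le zero_le_one]
    exact (hJc.integrableOn_compact (isCompact_Icc.prod isCompact_Icc)).mono_set
      (prod_mono Ioc_subset_Icc_self Ioc_subset_Icc_self)
  have hswap := intervalIntegral_intervalIntegral_swap hJi
  have hJy : IntervalIntegrable (fun y => ∫ q in (0 : ℝ)..1, J y q) volume 0 T := by
    rw [intervalIntegrable_iff]
    have h1 : Integrable J.uncurry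
        ((volume.restrict (uIoc 0 T)).prod (volume.restrict (uIoc 0 1))) := by
      rw [Measure.prod_restrict]; exact hJi
    simp only [intervalIntegral.integral_of_le (zero_le_one' ℝ)]
    rw [uIoc_of_le (zero_le_one' ℝ)] at h1
    exact h1.integral_prod_left
  -- substituting `z = q y` contracts the range of integration to `[0, qT] ⊆ [0, T]`
  have hdil : ∀ q ∈ Ioc (0 : ℝ) 1, ∫ y in (0 : ℝ)..T, J y q ≤ m q * q ^ (-s) * A := by
    intro q hq
    have hq0 : 0 < q := hq.1
    have e1 : ∀ y ∈ uIcc 0 T, J y q =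
        m q * q ^ (s - w) * ((q * y) ^ w * u (q * y) ^ 2) := by
      intro y hy
      rw [uIcc_of_le hT] at hy
      simp only [hJ]
      rw [Real.mul_rpow hq0.le hy.1, Real.rpow_sub hq0]
      have := (Real.rpow_pos_of_pos hq0 w).ne'
      field_simp
    rw [intervalIntegral.integral_congr e1, intervalIntegral.integral_const_mul,
      intervalIntegral.integral_comp_mul_left (fun z => z ^ w * u z ^ 2) hq0.ne', mul_zero,
      smul_eq_mul]
    have hle : ∫ z in (0 : ℝ)..q * T, z ^ w * u z ^ 2 ≤ A := by
      refine intervalIntegral.integral_mono_interval le_rfl (by positivity)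
        (by nlinarith [hq.2]) ?_ ((hcw.mul (hu.pow 2)).intervalIntegrable _ _)
      refine (ae_restrict_mem measurableSet_Ioc).mono fun z hz => ?_
      have := hz.1.le
      simp only [Pi.zero_apply]
      positivity
    have hmq := hm0 q ⟨hq0.le, hq.2⟩
    have e2 : q ^ (s - w) * q⁻¹ = q ^ (-s) := by
      rw [← Real.rpow_neg_one, ← Real.rpow_add hq0]
      congr 1
      rw [hs]; ring
    calc m q * q ^ (s - w) * (q⁻¹ * ∫ z in (0 : ℝ)..q * T, z ^ w * u z ^ 2)
        = m q * (q ^ (s - w) * q⁻¹) * ∫ z in (0 : ℝ)..q * T, z ^ w * u z ^ 2 := by ring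
      _ ≤ m q * q ^ (-s) * A := by
        rw [e2]
        gcongr
  have hJA : ∫ y in (0 : ℝ)..T, ∫ q in (0 : ℝ)..1, J y q ≤ I * A := by
    rw [hswap, ← hI, ← intervalIntegral.integral_mul_const]
    refine intervalIntegral.integral_mono_on_of_le_Ioo zero_le_one ?_ (hint.mul_const A)
      fun q hq => hdil q ⟨hq.1, hq.2.le⟩
    rw [intervalIntegrable_iff]
    have h1 : Integrable J.uncurry
        ((volume.restrict (uIoc 0 T)).prod (volume.restrict (uIoc 0 1))) := by
      rw [Measure.prod_restrict]; exact hJi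
    simp only [intervalIntegral.integral_of_le hT]
    rw [uIoc_of_le hT] at h1
    exact h1.integral_prod_right
  have hfi : IntervalIntegrable (fun y => y ^ w * f y ^ 2) volume 0 T :=
    (hcw.mul (hf.pow 2)).intervalIntegrable _ _
  have hpt : ∀ y ∈ Icc 0 T, y ^ w * (f y * ∫ q in (0 : ℝ)..1, m q * u (q * y)) ≤
      l / 2 * I * (y ^ w * f y ^ 2) + 1 / (2 * l) * ∫ q in (0 : ℝ)..1, J y q := by
    intro y hy
    have hyw : 0 ≤ y ^ w := Real.rpow_nonneg hy.1 w
    have hi1 : IntervalIntegrable (fun q => f y * (m q * u (q * y))) volume 0 1 := by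
      refine ContinuousOn.intervalIntegrable ?_
      rw [uIcc_of_le zero_le_one]
      exact continuousOn_const.mul (hm.mul (by fun_prop))
    have hi2 : IntervalIntegrable (fun q => m q * q ^ s * u (q * y) ^ 2) volume 0 1 := by
      refine ContinuousOn.intervalIntegrable ?_
      rw [uIcc_of_le zero_le_one]
      exact (hm.mul hcs.continuousOn).mul (by fun_prop)
    have h1 : f y * ∫ q in (0 : ℝ)..1, m q * u (q * y) ≤
        l / 2 * f y ^ 2 * I + 1 / (2 * l) * ∫ q in (0 : ℝ)..1, m q * q ^ s * u (q * y) ^ 2 := by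
      rw [← intervalIntegral.integral_const_mul, ← hI, ← intervalIntegral.integral_const_mul,
        ← intervalIntegral.integral_const_mul,
        ← intervalIntegral.integral_add (hint.const_mul _) (hi2.const_mul _)]
      refine intervalIntegral.integral_mono_on_of_le_Ioo zero_le_one hi1
        ((hint.const_mul _).add (hi2.const_mul _)) fun q hq => ?_
      have hmq := hm0 q ⟨hq.1.le, hq.2.le⟩
      have hqs : 0 < q ^ s := Real.rpow_pos_of_pos hq.1 s
      rw [Real.rpow_neg hq.1.le]
      have h2 : f y * u (q * y) ≤ l / 2 * f y ^ 2 * (q ^ s)⁻¹ +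
          1 / (2 * l) * (q ^ s * u (q * y) ^ 2) := by
        have h3 : 0 ≤ (l * f y - q ^ s * u (q * y)) ^ 2 * (1 / (2 * l) * (q ^ s)⁻¹) := by
          positivity
        have h4 : (l * f y - q ^ s * u (q * y)) ^ 2 * (1 / (2 * l) * (q ^ s)⁻¹) =
            l / 2 * f y ^ 2 * (q ^ s)⁻¹ + 1 / (2 * l) * (q ^ s * u (q * y) ^ 2)
              - f y * u (q * y) := by
          field_simp
          ring
        linarith
      nlinarith [mul_le_mul_of_nonneg_left h2 hmq]
    have h5 : ∫ q in (0 : ℝ)..1, J y q =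
        y ^ w * ∫ q in (0 : ℝ)..1, m q * q ^ s * u (q * y) ^ 2 := by
      rw [← intervalIntegral.integral_const_mul]
    rw [h5]
    nlinarith [mul_le_mul_of_nonneg_left h1 hyw]
  have hLi : IntervalIntegrable
      (fun y => y ^ w * (f y * ∫ q in (0 : ℝ)..1, m q * u (q * y))) volume 0 T := by
    refine ContinuousOn.intervalIntegrable ?_
    rw [uIcc_of_le hT]
    exact hcw.continuousOn.mul (hf.continuousOn.mul hR)
  have hfinal := intervalIntegral.integral_mono_on hT hLi
    ((hfi.const_mul (l / 2 * I)).add (hJy.const_mul (1 / (2 * l)))) hpt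
  rw [intervalIntegral.integral_add (hfi.const_mul _) (hJy.const_mul _),
    intervalIntegral.integral_const_mul, intervalIntegral.integral_const_mul] at hfinal
  have h6 : 1 / (2 * l) * (∫ y in (0 : ℝ)..T, ∫ q in (0 : ℝ)..1, J y q) ≤
      1 / (2 * l) * (I * A) := by gcongr
  linarith

/-- A solution of `c g'(y) + g(y) = ∫₀¹ m(q) g'(qy) dq` is integrable on `(0, ∞)` as soon as
`∫₀¹ m(q) q^{-(w+1)/2} dq < c` for some `w > 1`. Testing the equation against `y^w g'` and `y^w g`
bounds `∫₀ᵀ y^w g²` by a multiple of `∫₀ᵀ y^{w-1} g²`, which can be absorbed. -/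
theorem integrableOn_of_pantograph {g g' m : ℝ → ℝ} {c w I : ℝ} (hc : 0 < c) (hw : 1 < w)
    (hg : ∀ y, HasDerivAt g (g' y) y) (hg' : Continuous g') (hm : ContinuousOn m (Icc 0 1))
    (hm0 : ∀ q ∈ Icc (0 : ℝ) 1, 0 ≤ m q)
    (hint : IntervalIntegrable (fun q => m q * q ^ (-((w + 1) / 2))) volume 0 1)
    (hI : ∫ q in (0 : ℝ)..1, m q * q ^ (-((w + 1) / 2)) = I) (hIc : I < c)
    (heq : ∀ y, 0 ≤ y → c * g' y + g y = ∫ q in (0 : ℝ)..1, m q * g' (q * y)) :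
    IntegrableOn g (Ioi 0) := by
  have hgc : Continuous g := continuous_iff_continuousAt.2 fun y => (hg y).continuousAt
  have hw0 : 0 < w := by linarith
  have hcw : Continuous fun y : ℝ => y ^ w := Real.continuous_rpow_const hw0.le
  have hcw1 : Continuous fun y : ℝ => y ^ (w - 1) := Real.continuous_rpow_const (by linarith)
  set K := c * w + c ^ 2 * w / (2 * (c - I)) with hK
  have hcI : 0 < c - I := by linarith
  have hK0 : 0 < K := by positivity
  -- `K` is the constant in `∫ y^w g² ≤ K ∫ y^(w-1) g²`; beyond `ρ = 2K` at most half is absorbed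
  set ρ := 2 * K with hρ
  have hρ0 : 0 < ρ := by positivity
  set C0 := ∫ y in (0 : ℝ)..ρ, y ^ (w - 1) * g y ^ 2 with hC0
  have key : ∀ T, ρ ≤ T → ∫ y in (0 : ℝ)..T, y ^ w * g y ^ 2 ≤ 2 * K * C0 := by
    intro T hT
    have hT0 : 0 ≤ T := hρ0.le.trans hT
    set A := ∫ y in (0 : ℝ)..T, y ^ w * g' y ^ 2 with hA
    set B := ∫ y in (0 : ℝ)..T, y ^ w * g y ^ 2 with hB
    set N := ∫ y in (0 : ℝ)..T, y ^ (w - 1) * g y ^ 2 with hN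
    have hR : ContinuousOn (fun y => ∫ q in (0 : ℝ)..1, m q * g' (q * y)) (Icc 0 T) :=
      ((continuous_const.mul hg').add hgc).continuousOn.congr fun y hy => (heq y hy.1).symm
    have iA : IntervalIntegrable (fun y => y ^ w * g' y ^ 2) volume 0 T :=
      (hcw.mul (hg'.pow 2)).intervalIntegrable _ _
    have iB : ∀ a b, IntervalIntegrable (fun y => y ^ w * g y ^ 2) volume a b := fun a b =>
      (hcw.mul (hgc.pow 2)).intervalIntegrable _ _
    have iN : ∀ a b, IntervalIntegrable (fun y => y ^ (w - 1) * g y ^ 2) volume a b := fun a b =>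
      (hcw1.mul (hgc.pow 2)).intervalIntegrable _ _
    have iX : IntervalIntegrable (fun y => y ^ w * (g y * g' y)) volume 0 T :=
      (hcw.mul (hgc.mul hg')).intervalIntegrable _ _
    -- integration by parts
    have hparts : w / 2 * N + ∫ y in (0 : ℝ)..T, y ^ w * (g y * g' y) = T ^ w * g T ^ 2 / 2 := by
      have hd : ∀ y ∈ uIcc 0 T, HasDerivAt (fun y => y ^ w * g y ^ 2 / 2)
          (w / 2 * (y ^ (w - 1) * g y ^ 2) + y ^ w * (g y * g' y)) y := by
        intro y _
        refine (((Real.hasDerivAt_rpow_const (x := y) (p := w) (Or.inr hw.le)).mul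
          ((hg y).pow 2)).div_const 2).congr_deriv ?_
        simp only [Pi.pow_apply]
        push_cast
        ring
      rw [hN, ← intervalIntegral.integral_const_mul,
        ← intervalIntegral.integral_add ((iN 0 T).const_mul _) iX,
        intervalIntegral.integral_eq_sub_of_hasDerivAt hd (((iN 0 T).const_mul _).add iX),
        Real.zero_rpow hw0.ne']
      ring
    have hD : 0 ≤ T ^ w * g T ^ 2 / 2 := by positivity
    -- the equation tested against `y ^ w * g'`
    have t1 := integral_weight_mul_average_le hw0 one_pos hT0 hg' hg' hm hm0 hint hI hR
    have l1 : ∫ y in (0 : ℝ)..T, y ^ w * (g' y * ∫ q in (0 : ℝ)..1, m q * g' (q * y)) =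
        c * A + ∫ y in (0 : ℝ)..T, y ^ w * (g y * g' y) := by
      rw [hA, ← intervalIntegral.integral_const_mul,
        ← intervalIntegral.integral_add (iA.const_mul _) iX]
      refine intervalIntegral.integral_congr fun y hy => ?_
      rw [uIcc_of_le hT0] at hy
      simp only [← heq y hy.1]
      ring
    -- the equation tested against `y ^ w * g`
    have t2 := integral_weight_mul_average_le (l := 1 / c) hw0 (by positivity) hT0 hgc hg' hm hm0
      hint hI hR
    have l2 : ∫ y in (0 : ℝ)..T, y ^ w * (g y * ∫ q in (0 : ℝ)..1, m q * g' (q * y)) =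
        c * (∫ y in (0 : ℝ)..T, y ^ w * (g y * g' y)) + B := by
      rw [hB, ← intervalIntegral.integral_const_mul,
        ← intervalIntegral.integral_add (iX.const_mul _) (iB 0 T)]
      refine intervalIntegral.integral_congr fun y hy => ?_
      rw [uIcc_of_le hT0] at hy
      simp only [← heq y hy.1]
      ring
    rw [l1] at t1
    rw [l2] at t2
    have hpos : ∀ {f : ℝ → ℝ} {p : ℝ}, 0 ≤ ∫ y in (0 : ℝ)..T, y ^ p * f y ^ 2 := fun {f p} =>
      intervalIntegral.integral_nonneg hT0 fun y hy =>
        mul_nonneg (Real.rpow_nonneg hy.1 _) (sq_nonneg _)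
    have hA0 : 0 ≤ A := hpos
    have hB0 : 0 ≤ B := hpos
    have hN0 : 0 ≤ N := hpos
    set X := ∫ y in (0 : ℝ)..T, y ^ w * (g y * g' y) with hX
    have b1 : (c - I) * A ≤ w / 2 * N := by
      have : 1 / 2 * I * A + 1 / (2 * 1) * I * A = I * A := by ring
      linarith
    have b1' : A ≤ w * N / (2 * (c - I)) := by
      rw [le_div_iff₀ (by positivity)]
      linarith
    have b2 : B / 2 ≤ c * w / 2 * N + c ^ 2 / 2 * A := by
      have e1 : 1 / c / 2 * I * B ≤ 1 / c / 2 * c * B := by gcongr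
      have e2 : 1 / (2 * (1 / c)) * I * A ≤ 1 / (2 * (1 / c)) * c * A := by gcongr
      have e3 : 1 / c / 2 * c * B = B / 2 := by field_simp
      have e4 : 1 / (2 * (1 / c)) * c * A = c ^ 2 / 2 * A := by field_simp
      have e5 : c * (w / 2 * N) + c * X = c * (T ^ w * g T ^ 2 / 2) := by rw [← hparts]; ring
      have e6 : 0 ≤ c * (T ^ w * g T ^ 2 / 2) := by positivity
      linarith
    have b3 : B ≤ K * N := by
      have : c ^ 2 * A ≤ c ^ 2 * (w * N / (2 * (c - I))) := by gcongr
      have e : K * N = c * w * N + c ^ 2 * (w * N / (2 * (c - I))) := by rw [hK]; ring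
      linarith
    -- for `y ≥ ρ` the weight `y ^ (w - 1)` is at most `y ^ w / ρ`
    have b4 : N ≤ C0 + B / ρ := by
      rw [hN, ← intervalIntegral.integral_add_adjacent_intervals (iN 0 ρ) (iN ρ T)]
      have e1 : ∫ y in ρ..T, y ^ (w - 1) * g y ^ 2 ≤ ∫ y in ρ..T, 1 / ρ * (y ^ w * g y ^ 2) := by
        refine intervalIntegral.integral_mono_on hT (iN _ _) ((iB _ _).const_mul _) fun y hy => ?_
        have hy0 : 0 < y := hρ0.trans_le hy.1
        rw [Real.rpow_sub_one hy0.ne', ← mul_assoc]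
        have : y ^ w / y ≤ 1 / ρ * y ^ w := by
          rw [div_eq_mul_one_div, mul_comm]
          gcongr
          exact hy.1
        gcongr
      have e2 : ∫ y in ρ..T, y ^ w * g y ^ 2 ≤ B := by
        rw [hB, ← intervalIntegral.integral_add_adjacent_intervals (iB 0 ρ) (iB ρ T)]
        have : 0 ≤ ∫ y in (0 : ℝ)..ρ, y ^ w * g y ^ 2 :=
          intervalIntegral.integral_nonneg hρ0.le fun y hy =>
            mul_nonneg (Real.rpow_nonneg hy.1 _) (sq_nonneg _)
        linarith
      rw [intervalIntegral.integral_const_mul] at e1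
      have e3 : 1 / ρ * ∫ y in ρ..T, y ^ w * g y ^ 2 ≤ 1 / ρ * B := by gcongr
      have e4 : 1 / ρ * B = B / ρ := by ring
      linarith
    have b5 : K * N ≤ K * (C0 + B / ρ) := by gcongr
    have b6 : K * (C0 + B / ρ) = K * C0 + B / 2 := by rw [hρ]; field_simp
    linarith
  have hL2 : IntegrableOn (fun y => y ^ w * g y ^ 2) (Ioi 0) := by
    refine integrableOn_Ioi_of_intervalIntegral_norm_bounded (b := fun T : ℝ => T)
      (l := Filter.atTop) (2 * K * C0) 0
      (fun T => ((hcw.mul (hgc.pow 2)).integrableOn_Icc).mono_set Ioc_subset_Icc_self)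
      Filter.tendsto_id ?_
    filter_upwards [Filter.eventually_ge_atTop ρ] with T hT
    rw [intervalIntegral.integral_congr (g := fun y => y ^ w * g y ^ 2)]
    · exact key T hT
    · intro y hy
      rw [uIcc_of_le (hρ0.le.trans hT)] at hy
      exact Real.norm_of_nonneg (mul_nonneg (Real.rpow_nonneg hy.1 _) (sq_nonneg _))
  rw [← Ioc_union_Ioi_eq_Ioi (zero_le_one' ℝ)]
  refine IntegrableOn.union (hgc.integrableOn_Icc.mono_set Ioc_subset_Icc_self) ?_
  have h1 : IntegrableOn (fun y => y ^ w * g y ^ 2 + y ^ (-w)) (Ioi 1) :=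
    (hL2.mono_set (Ioi_subset_Ioi zero_le_one)).add
      (integrableOn_Ioi_rpow_of_lt (by linarith) one_pos)
  -- Cauchy–Schwarz at infinity: `2|g| ≤ y^w g² + y^{-w}`
  refine Integrable.mono' h1 hgc.aestronglyMeasurable ?_
  refine (ae_restrict_mem measurableSet_Ioi).mono fun y hy => ?_
  have hy0 : (0 : ℝ) < y := zero_lt_one.trans hy
  have hyw : 0 < y ^ w := Real.rpow_pos_of_pos hy0 w
  rw [Real.norm_eq_abs, Real.rpow_neg hy0.le]
  have h2 : 0 ≤ (y ^ w * |g y| - 1) ^ 2 * (y ^ w)⁻¹ := by positivity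
  have h3 : (y ^ w * |g y| - 1) ^ 2 * (y ^ w)⁻¹ = y ^ w * g y ^ 2 + (y ^ w)⁻¹ - 2 * |g y| := by
    rw [← sq_abs (g y)]
    field_simp
    ring
  have h4 := abs_nonneg (g y)
  linarith

/-! ### The profile `(1 - α q^{1/γ})^{-γ}` and the factors `F_j` -/

/-- The kernel `φ(q) = (1 - α q^{1/γ})^{-γ}` of the integral equation in the variable
`v = x^{-γ}`. -/
noncomputable def sunProfile (γ α q : ℝ) : ℝ := 1 / (1 - α * q ^ (1 / γ)) ^ γ

/-- The weight `q φ'(q)` on `[0, 1]`, where `φ` is `sunProfile`; unlike `φ'` it is continuous at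
`0`. -/
noncomputable def sunWeight (γ α q : ℝ) : ℝ :=
  α * q ^ (1 / γ) / (1 - α * q ^ (1 / γ)) ^ (γ + 1)

section Profile

variable {γ α : ℝ} (hγ : 0 < γ) (hα0 : 0 < α) (hα1 : α < 1)
include hγ hα0

theorem sunProfile_base_mem {q : ℝ} (hq : q ∈ Icc (0 : ℝ) 1) :
    1 - α ≤ 1 - α * q ^ (1 / γ) ∧ 1 - α * q ^ (1 / γ) ≤ 1 := by
  have h1 : q ^ (1 / γ) ≤ 1 := Real.rpow_le_one hq.1 hq.2 (by positivity)
  have h0 : 0 ≤ q ^ (1 / γ) := Real.rpow_nonneg hq.1 _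
  constructor <;> nlinarith

include hα1

theorem sunProfile_base_pos {q : ℝ} (hq : q ∈ Icc (0 : ℝ) 1) : 0 < 1 - α * q ^ (1 / γ) :=
  (sub_pos.2 hα1).trans_le (sunProfile_base_mem hγ hα0 hq).1

theorem one_le_sunProfile {q : ℝ} (hq : q ∈ Icc (0 : ℝ) 1) : 1 ≤ sunProfile γ α q := by
  have h := sunProfile_base_pos hγ hα0 hα1 hq
  exact (one_le_div (Real.rpow_pos_of_pos h γ)).2
    (Real.rpow_le_one h.le (sunProfile_base_mem hγ hα0 hq).2 hγ.le)

theorem sunProfile_le {q : ℝ} (hq : q ∈ Icc (0 : ℝ) 1) :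
    sunProfile γ α q ≤ 1 / (1 - α) ^ γ := by
  have h := sub_pos.2 hα1
  exact one_div_le_one_div_of_le (Real.rpow_pos_of_pos h γ)
    (Real.rpow_le_rpow h.le (sunProfile_base_mem hγ hα0 hq).1 hγ.le)

theorem sunProfile_continuousOn : ContinuousOn (sunProfile γ α) (Icc 0 1) := by
  have hc : Continuous fun q : ℝ => q ^ (1 / γ) := Real.continuous_rpow_const (by positivity)
  refine continuousOn_const.div (ContinuousOn.rpow_const (by fun_prop) fun q hq =>
    Or.inr hγ.le) fun q hq => ?_
  exact (Real.rpow_pos_of_pos (sunProfile_base_pos hγ hα0 hα1 hq) _).ne'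

theorem sunWeight_continuousOn : ContinuousOn (sunWeight γ α) (Icc 0 1) := by
  have hc : Continuous fun q : ℝ => q ^ (1 / γ) := Real.continuous_rpow_const (by positivity)
  refine ContinuousOn.div (by fun_prop) (ContinuousOn.rpow_const (by fun_prop) fun q hq =>
    Or.inr (by positivity)) fun q hq => ?_
  exact (Real.rpow_pos_of_pos (sunProfile_base_pos hγ hα0 hα1 hq) _).ne'

theorem sunWeight_nonneg {q : ℝ} (hq : q ∈ Icc (0 : ℝ) 1) : 0 ≤ sunWeight γ α q :=
  div_nonneg (mul_nonneg hα0.le (Real.rpow_nonneg hq.1 _))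
    (Real.rpow_nonneg (sunProfile_base_pos hγ hα0 hα1 hq).le _)

theorem sunWeight_le {q : ℝ} (hq : q ∈ Icc (0 : ℝ) 1) :
    sunWeight γ α q ≤ α / (1 - α) ^ (γ + 1) * q ^ (1 / γ) := by
  have h := sub_pos.2 hα1
  have h2 : 0 ≤ q ^ (1 / γ) := Real.rpow_nonneg hq.1 _
  have h3 : 0 < (1 - α) ^ (γ + 1) := Real.rpow_pos_of_pos h _
  calc sunWeight γ α q ≤ α * q ^ (1 / γ) / (1 - α) ^ (γ + 1) := by
        refine div_le_div_of_nonneg_left (by positivity) h3 ?_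
        exact Real.rpow_le_rpow h.le (sunProfile_base_mem hγ hα0 hq).1 (by positivity)
    _ = _ := by ring

theorem sunProfile_hasDerivAt {q : ℝ} (hq : q ∈ Ioo (0 : ℝ) 1) :
    HasDerivAt (sunProfile γ α) (sunWeight γ α q * q⁻¹) q := by
  have hb := sunProfile_base_pos hγ hα0 hα1 (Ioo_subset_Icc_self hq)
  have h1 : HasDerivAt (fun q : ℝ => 1 - α * q ^ (1 / γ)) (-(α * (1 / γ * q ^ (1 / γ - 1)))) q :=
    ((Real.hasDerivAt_rpow_const (Or.inl hq.1.ne')).const_mul α).const_sub 1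
  have h2 := (h1.rpow_const (p := γ) (Or.inl hb.ne')).inv (Real.rpow_pos_of_pos hb γ).ne'
  have he : sunProfile γ α = fun q => ((1 - α * q ^ (1 / γ)) ^ γ)⁻¹ := by
    funext q; rw [sunProfile, one_div]
  rw [he]
  refine h2.congr_deriv ?_
  rw [sunWeight, Real.rpow_sub_one hb.ne', Real.rpow_sub_one hq.1.ne', Real.rpow_add_one hb.ne']
  have := (Real.rpow_pos_of_pos hb γ).ne'
  have := hq.1.ne'
  field_simp

theorem integral_sunWeight_mul_inv :
    IntervalIntegrable (fun q => sunWeight γ α q * q⁻¹) volume 0 1 ∧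
      ∫ q in (0 : ℝ)..1, sunWeight γ α q * q⁻¹ = 1 / (1 - α) ^ γ - 1 := by
  have hi : IntervalIntegrable (fun q => sunWeight γ α q * q⁻¹) volume 0 1 := by
    rw [intervalIntegrable_iff, uIoc_of_le zero_le_one]
    exact intervalIntegral.integrableOn_deriv_of_nonneg (sunProfile_continuousOn hγ hα0 hα1)
      (fun q hq => sunProfile_hasDerivAt hγ hα0 hα1 hq) fun q hq =>
        mul_nonneg (sunWeight_nonneg hγ hα0 hα1 (Ioo_subset_Icc_self hq)) (inv_nonneg.2 hq.1.le)
  refine ⟨hi, ?_⟩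
  rw [intervalIntegral.integral_eq_sub_of_hasDerivAt_of_le zero_le_one
    (sunProfile_continuousOn hγ hα0 hα1) (fun q hq => sunProfile_hasDerivAt hγ hα0 hα1 hq) hi]
  simp [sunProfile, Real.zero_rpow (inv_ne_zero hγ.ne')]

/-- Integration by parts: `∫₀¹ (q^{l+1} φ(q))' dq = φ(1)`. -/
theorem integral_pow_mul_sunProfile (l : ℕ) :
    ((l : ℝ) + 1) * ∫ q in (0 : ℝ)..1, q ^ l * sunProfile γ α q =
      1 / (1 - α) ^ γ - ∫ q in (0 : ℝ)..1, q ^ l * sunWeight γ α q := by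
  have i1 : IntervalIntegrable (fun q => q ^ l * sunProfile γ α q) volume 0 1 := by
    refine ContinuousOn.intervalIntegrable ?_
    rw [uIcc_of_le zero_le_one]
    exact (by fun_prop : Continuous fun q : ℝ => q ^ l).continuousOn.mul
      (sunProfile_continuousOn hγ hα0 hα1)
  have i2 : IntervalIntegrable (fun q => q ^ l * sunWeight γ α q) volume 0 1 := by
    refine ContinuousOn.intervalIntegrable ?_
    rw [uIcc_of_le zero_le_one]
    exact (by fun_prop : Continuous fun q : ℝ => q ^ l).continuousOn.mul
      (sunWeight_continuousOn hγ hα0 hα1)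
  have hd : ∀ q ∈ Ioo (0 : ℝ) 1, HasDerivAt (fun q => q ^ (l + 1) * sunProfile γ α q)
      (((l : ℝ) + 1) * (q ^ l * sunProfile γ α q) + q ^ l * sunWeight γ α q) q := by
    intro q hq
    refine ((hasDerivAt_pow (l + 1) q).mul (sunProfile_hasDerivAt hγ hα0 hα1 hq)).congr_deriv ?_
    have := hq.1.ne'
    push_cast
    rw [pow_succ]
    field_simp
  have h := intervalIntegral.integral_eq_sub_of_hasDerivAt_of_le zero_le_one
    ((by fun_prop : Continuous fun q : ℝ => q ^ (l + 1)).continuousOn.mul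
      (sunProfile_continuousOn hγ hα0 hα1)) hd ((i1.const_mul _).add i2)
  rw [intervalIntegral.integral_add (i1.const_mul _) i2, intervalIntegral.integral_const_mul] at h
  have h1 : sunProfile γ α 1 = 1 / (1 - α) ^ γ := by simp [sunProfile]
  simp only [Pi.mul_apply, h1, one_pow, one_mul, ne_eq, Nat.add_eq_zero_iff, one_ne_zero,
    and_false, not_false_eq_true, zero_pow, zero_mul, sub_zero] at h
  linarith

/-- At `w = 1` the constant `∫₀¹ q φ'(q) q^{-(w+1)/2} dq` equals `φ(1) - 1`; it stays below `φ(1)`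
for `w` slightly larger than `1`. -/
theorem exists_sunWeight_exponent : ∃ w : ℝ, 1 < w ∧
    IntervalIntegrable (fun q => sunWeight γ α q * q ^ (-((w + 1) / 2))) volume 0 1 ∧
    ∫ q in (0 : ℝ)..1, sunWeight γ α q * q ^ (-((w + 1) / 2)) < 1 / (1 - α) ^ γ := by
  set D := α / (1 - α) ^ (γ + 1) with hD
  have hD0 : 0 < D := div_pos hα0 (Real.rpow_pos_of_pos (sub_pos.2 hα1) _)
  have hγ' : 0 < 1 / γ := by positivity
  obtain ⟨β, hβ, hβγ, hβ0⟩ : ∃ β : ℝ, D * (1 / (1 / γ - β) - γ) < 1 ∧ β < 1 / γ ∧ 0 < β := by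
    have hc : ContinuousAt (fun β : ℝ => D * (1 / (1 / γ - β) - γ)) 0 := by
      have : (1 / γ - 0) ≠ 0 := by rw [sub_zero]; exact hγ'.ne'
      fun_prop (disch := assumption)
    have ht := hc.tendsto
    rw [sub_zero, one_div_one_div, sub_self, mul_zero] at ht
    have e1 := (ht.mono_left (nhdsWithin_le_nhds (s := Ioi 0))).eventually
      (gt_mem_nhds one_pos)
    have e2 : ∀ᶠ β in nhdsWithin (0 : ℝ) (Ioi 0), β < 1 / γ :=
      nhdsWithin_le_nhds (gt_mem_nhds hγ')
    obtain ⟨β, h⟩ := (e1.and (e2.and self_mem_nhdsWithin)).exists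
    exact ⟨β, h.1, h.2.1, h.2.2⟩
  refine ⟨1 + 2 * β, by linarith, ?_⟩
  have hexp : -((1 + 2 * β + 1) / 2) = -1 - β := by ring
  rw [hexp]
  obtain ⟨i1, e1⟩ := integral_sunWeight_mul_inv hγ hα0 hα1
  have i2 : IntervalIntegrable (fun q : ℝ => q ^ (1 / γ - 1 - β)) volume 0 1 :=
    intervalIntegral.intervalIntegrable_rpow' (by linarith)
  have i3 : IntervalIntegrable (fun q : ℝ => q ^ (1 / γ - 1)) volume 0 1 :=
    intervalIntegral.intervalIntegrable_rpow' (by linarith)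
  have e2 : ∫ q in (0 : ℝ)..1, q ^ (1 / γ - 1 - β) = 1 / (1 / γ - β) := by
    rw [integral_rpow (Or.inl (by linarith)), Real.one_rpow, Real.zero_rpow (by linarith)]
    congr 1 <;> ring
  have e3 : ∫ q in (0 : ℝ)..1, q ^ (1 / γ - 1) = γ := by
    rw [integral_rpow (Or.inl (by linarith)), Real.one_rpow, Real.zero_rpow (by linarith)]
    simp
  have i4 := i1.add ((i2.sub i3).const_mul D)
  -- the excess over the case `β = 0` is at most `D (q^{1/γ-1-β} - q^{1/γ-1})`, of small integral
  have hpt : ∀ q ∈ Ioc (0 : ℝ) 1, sunWeight γ α q * q ^ (-1 - β) ≤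
      sunWeight γ α q * q⁻¹ + D * (q ^ (1 / γ - 1 - β) - q ^ (1 / γ - 1)) := by
    intro q hq
    have hq' : q ∈ Icc (0 : ℝ) 1 := Ioc_subset_Icc_self hq
    have h1 := sunWeight_le hγ hα0 hα1 hq'
    have h2 : 1 ≤ q ^ (-β) := Real.one_le_rpow_of_pos_of_le_one_of_nonpos hq.1 hq.2 (by linarith)
    have h3 : q ^ (-1 - β) = q⁻¹ * q ^ (-β) := by
      rw [← Real.rpow_neg_one, ← Real.rpow_add hq.1]; congr 1
    have h4 : q ^ (1 / γ - 1 - β) = q ^ (1 / γ) * q⁻¹ * q ^ (-β) := by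
      rw [← Real.rpow_neg_one, ← Real.rpow_add hq.1, ← Real.rpow_add hq.1]; congr 1
    have h5 : q ^ (1 / γ - 1) = q ^ (1 / γ) * q⁻¹ := by
      rw [← Real.rpow_neg_one, ← Real.rpow_add hq.1]; congr 1
    rw [h3, h4, h5]
    have h6 : 0 ≤ q⁻¹ * (q ^ (-β) - 1) := mul_nonneg (inv_nonneg.2 hq.1.le) (by linarith)
    nlinarith [mul_le_mul_of_nonneg_right h1 h6]
  have hi : IntervalIntegrable (fun q => sunWeight γ α q * q ^ (-1 - β)) volume 0 1 := by
    rw [intervalIntegrable_iff, uIoc_of_le zero_le_one] at i4 ⊢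
    refine Integrable.mono' i4 ?_ ((ae_restrict_mem measurableSet_Ioc).mono fun q hq => ?_)
    · refine ContinuousOn.aestronglyMeasurable ?_ measurableSet_Ioc
      exact ((sunWeight_continuousOn hγ hα0 hα1).mono Ioc_subset_Icc_self).mul
        (continuousOn_id.rpow_const fun q hq => Or.inl hq.1.ne')
    · rw [Real.norm_of_nonneg (mul_nonneg
        (sunWeight_nonneg hγ hα0 hα1 (Ioc_subset_Icc_self hq)) (Real.rpow_nonneg hq.1.le _))]
      exact hpt q hq
  refine ⟨hi, ?_⟩
  have h := intervalIntegral.integral_mono_on_of_le_Ioo zero_le_one hi i4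
    fun q hq => hpt q ⟨hq.1, hq.2.le⟩
  rw [intervalIntegral.integral_add i1 ((i2.sub i3).const_mul D), e1,
    intervalIntegral.integral_const_mul, intervalIntegral.integral_sub i2 i3, e2, e3] at h
  linarith

theorem hasSum_sunProfile {q : ℝ} (hq : q ∈ Icc (0 : ℝ) 1) :
    HasSum (fun n : ℕ => (ascPochhammer ℝ n).eval γ / (n.factorial : ℝ) *
      (α * q ^ (1 / γ)) ^ n) (sunProfile γ α q) := by
  have hx0 : 0 ≤ α * q ^ (1 / γ) := mul_nonneg hα0.le (Real.rpow_nonneg hq.1 _)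
  have hx1 : α * q ^ (1 / γ) < 1 := by
    have := sunProfile_base_pos hγ hα0 hα1 hq
    linarith
  have h := (Real.one_div_one_sub_rpow_hasFPowerSeriesOnBall_zero γ).hasSum
    (y := α * q ^ (1 / γ)) (by
      rw [← ENNReal.ofReal_one, Metric.eball_ofReal, mem_ball_zero_iff, Real.norm_of_nonneg hx0]
      exact hx1)
  rw [zero_add] at h
  have he : ∀ n : ℕ, (FormalMultilinearSeries.ofScalars ℝ
      (fun n : ℕ => Ring.choose (γ + n - 1) n) n fun _ => α * q ^ (1 / γ)) =
      (ascPochhammer ℝ n).eval γ / (n.factorial : ℝ) * (α * q ^ (1 / γ)) ^ n := by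
    intro n
    rw [FormalMultilinearSeries.ofScalars_apply_eq, smul_eq_mul, ← Ring.multichoose_eq,
      ← Polynomial.ascPochhammer_smeval_eq_eval,
      ← Ring.factorial_nsmul_multichoose_eq_ascPochhammer, nsmul_eq_mul,
      mul_div_cancel_left₀ _ (by positivity)]
  simp only [he] at h
  exact h

omit hγ hα0 hα1 in
theorem ascPochhammer_eval_mul_add (b : ℝ) (n : ℕ) :
    (ascPochhammer ℝ n).eval b * (b + n) = b * (ascPochhammer ℝ n).eval (1 + b) := by
  rw [← ascPochhammer_succ_eval, ascPochhammer_succ_left, Polynomial.eval_mul,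
    Polynomial.eval_X, Polynomial.eval_comp]
  simp [add_comm]

/-- Euler's integral for `₂F₁(γ, b; 1 + b; α)` with `b = (l + 1) γ`, in the variable
`q = z^γ`. -/
theorem sunFactor_succ (l : ℕ) :
    sunFactor γ α (l + 1) = ((l : ℝ) + 1) * ∫ q in (0 : ℝ)..1, q ^ l * sunProfile γ α q := by
  set d : ℕ → ℝ := fun n => (ascPochhammer ℝ n).eval γ / (n.factorial : ℝ) * α ^ n with hd
  have hd0 : ∀ n, 0 ≤ d n := fun n => by
    have := (ascPochhammer_pos n γ hγ).le
    positivity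
  have hds : Summable d := by
    have := (hasSum_sunProfile hγ hα0 hα1 (q := 1) ⟨zero_le_one, le_rfl⟩).summable
    simpa [hd] using this
  set F : ℕ → ℝ → ℝ := fun n q => d n * q ^ ((l : ℝ) + n / γ) with hF
  have hex : ∀ n : ℕ, 0 ≤ (l : ℝ) + n / γ := fun n => by positivity
  have hval : ∀ n, ∫ q in Ioc (0 : ℝ) 1, F n q = d n * (1 / ((l : ℝ) + n / γ + 1)) := by
    intro n
    have hne : (l : ℝ) + n / γ + 1 ≠ 0 := by have := hex n; positivity
    rw [← intervalIntegral.integral_of_le zero_le_one, hF]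
    simp only []
    rw [intervalIntegral.integral_const_mul,
      integral_rpow (Or.inl (by have := hex n; linarith)), Real.one_rpow,
      Real.zero_rpow hne, sub_zero]
  have hint : ∀ n, IntegrableOn (F n) (Ioc 0 1) := fun n => by
    have : IntervalIntegrable (F n) volume 0 1 :=
      (intervalIntegral.intervalIntegrable_rpow' (by have := hex n; linarith)).const_mul _
    rwa [intervalIntegrable_iff, uIoc_of_le zero_le_one] at this
  have hnorm : ∀ n, ∫ q in Ioc (0 : ℝ) 1, ‖F n q‖ = ∫ q in Ioc (0 : ℝ) 1, F n q := by
    intro n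
    refine setIntegral_congr_fun measurableSet_Ioc fun q hq => ?_
    exact Real.norm_of_nonneg (mul_nonneg (hd0 n) (Real.rpow_nonneg hq.1.le _))
  have hS := hasSum_integral_of_summable_integral_norm hint (by
    simp only [hnorm, hval]
    refine Summable.of_nonneg_of_le (fun n => ?_) (fun n => ?_) hds
    · have := hex n
      exact mul_nonneg (hd0 n) (by positivity)
    · have := hex n
      refine mul_le_of_le_one_right (hd0 n) ((div_le_one (by positivity)).2 (by linarith)))
  simp only [hval] at hS
  have hpt : ∀ q ∈ Ioc (0 : ℝ) 1, ∑' n, F n q = q ^ l * sunProfile γ α q := by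
    intro q hq
    rw [← (hasSum_sunProfile hγ hα0 hα1 (Ioc_subset_Icc_self hq)).tsum_eq, ← tsum_mul_left]
    refine tsum_congr fun n => ?_
    simp only [hF, hd]
    rw [Real.rpow_add hq.1, Real.rpow_natCast, mul_pow, ← Real.rpow_natCast (q ^ (1 / γ)) n,
      ← Real.rpow_mul hq.1.le, one_div_mul_eq_div]
    ring
  rw [setIntegral_congr_fun measurableSet_Ioc hpt,
    ← intervalIntegral.integral_of_le zero_le_one] at hS
  rw [← hS.tsum_eq, ← tsum_mul_left, sunFactor, ordinaryHypergeometric_eq_tsum]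
  refine tsum_congr fun n => ?_
  simp only [hd, smul_eq_mul]
  push_cast
  have hb : 0 < ((l : ℝ) + 1) * γ := by positivity
  have h1 := ascPochhammer_eval_mul_add (((l : ℝ) + 1) * γ) n
  have h2 : 0 < (ascPochhammer ℝ n).eval (1 + ((l : ℝ) + 1) * γ) :=
    ascPochhammer_pos n _ (by positivity)
  have h3 : (ascPochhammer ℝ n).eval (((l : ℝ) + 1) * γ) *
      ((ascPochhammer ℝ n).eval (1 + ((l : ℝ) + 1) * γ))⁻¹ =
      ((l : ℝ) + 1) * (1 / ((l : ℝ) + n / γ + 1)) := by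
    have h4 : ((l : ℝ) + 1) * γ + n ≠ 0 := by positivity
    have h5 : (l : ℝ) + n / γ + 1 = (((l : ℝ) + 1) * γ + n) / γ := by field_simp; ring
    rw [h5, one_div_div, ← div_eq_mul_inv, mul_div_assoc', div_eq_div_iff h2.ne' h4]
    linarith
  rw [mul_assoc ((n.factorial : ℝ)⁻¹ * _), h3]
  ring

omit hγ hα0 hα1 in
theorem sunFactor_zero : sunFactor γ α 0 = 1 := by
  rw [sunFactor, ordinaryHypergeometric_eq_tsum]
  simp only [smul_eq_mul]
  rw [tsum_eq_single 0]
  · simp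
  · intro n hn
    have : (ascPochhammer ℝ n).eval ((0 : ℕ) * γ) = 0 := by
      rw [Nat.cast_zero, zero_mul]
      exact ascPochhammer_ne_zero_eval_zero ℝ hn
    rw [this]
    ring

theorem one_le_sunFactor (j : ℕ) : 1 ≤ sunFactor γ α j := by
  cases j with
  | zero => exact sunFactor_zero.ge
  | succ l =>
    rw [sunFactor_succ hγ hα0 hα1]
    have h : ∫ q in (0 : ℝ)..1, q ^ l ≤ ∫ q in (0 : ℝ)..1, q ^ l * sunProfile γ α q := by
      refine intervalIntegral.integral_mono_on zero_le_one (by simp) ?_ fun q hq => ?_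
      · refine ContinuousOn.intervalIntegrable ?_
        rw [uIcc_of_le zero_le_one]
        exact (by fun_prop : Continuous fun q : ℝ => q ^ l).continuousOn.mul
          (sunProfile_continuousOn hγ hα0 hα1)
      · exact le_mul_of_one_le_right (pow_nonneg hq.1 l) (one_le_sunProfile hγ hα0 hα1 hq)
    rw [integral_pow] at h
    simp only [one_pow, ne_eq, Nat.add_eq_zero_iff, one_ne_zero, and_false, not_false_eq_true,
      zero_pow, sub_zero] at h
    rwa [div_le_iff₀' (by positivity)] at h

end Profile

/-! ### The generating function -/

/-- The coefficients `a_l = 1 / (F_0 F_1 ⋯ F_l)` of `sunGen`. -/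
noncomputable def sunCoeff (γ α : ℝ) (l : ℕ) : ℝ :=
  1 / ∏ j ∈ Finset.range (l + 1), sunFactor γ α j

theorem sunGen_eq (γ α : ℝ) : sunGen γ α = altExp (sunCoeff γ α) := rfl

section Coeff

variable {γ α : ℝ} (hγ : 0 < γ) (hα0 : 0 < α) (hα1 : α < 1)
include hγ hα0 hα1

theorem sunCoeff_pos (l : ℕ) : 0 < sunCoeff γ α l :=
  one_div_pos.2 (Finset.prod_pos fun j _ =>
    zero_lt_one.trans_le (one_le_sunFactor hγ hα0 hα1 j))

theorem abs_sunCoeff_le (l : ℕ) : |sunCoeff γ α l| ≤ 1 := by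
  rw [abs_of_pos (sunCoeff_pos hγ hα0 hα1 l)]
  have h : 1 ≤ ∏ j ∈ Finset.range (l + 1), sunFactor γ α j :=
    Finset.prod_induction _ (fun x => 1 ≤ x) (fun _ _ => one_le_mul_of_one_le_of_one_le) le_rfl
      fun j _ => one_le_sunFactor hγ hα0 hα1 j
  exact (div_le_one (zero_lt_one.trans_le h)).2 h

omit hγ hα0 hα1 in
theorem sunCoeff_zero : sunCoeff γ α 0 = 1 := by
  simp [sunCoeff, sunFactor_zero]

theorem sunCoeff_succ_mul (l : ℕ) :
    sunCoeff γ α (l + 1) * sunFactor γ α (l + 1) = sunCoeff γ α l := by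
  have h := zero_lt_one.trans_le (one_le_sunFactor hγ hα0 hα1 (l + 1))
  rw [sunCoeff, Finset.prod_range_succ, sunCoeff, one_div, one_div, mul_inv, mul_assoc,
    inv_mul_cancel₀ h.ne', mul_one]

/-- The functional equation `c g'(y) + g(y) = ∫₀¹ q φ'(q) g'(qy) dq` with `c = φ(1)`. -/
theorem sunGen_pantograph (y : ℝ) :
    1 / (1 - α) ^ γ * (-altExp (fun n => sunCoeff γ α (n + 1)) y) + altExp (sunCoeff γ α) y =
      ∫ q in (0 : ℝ)..1, sunWeight γ α q *
        (-altExp (fun n => sunCoeff γ α (n + 1)) (q * y)) := by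
  have ha := abs_sunCoeff_le hγ hα0 hα1
  have ha' : ∀ n, |sunCoeff γ α (n + 1)| ≤ 1 := fun n => ha (n + 1)
  set F : ℕ → ℝ → ℝ := fun n q => sunWeight γ α q *
    (-((-(q * y)) ^ n / (n.factorial : ℝ) * sunCoeff γ α (n + 1))) with hF
  have hFe : ∀ n q, F n q = (-((-y) ^ n / (n.factorial : ℝ) * sunCoeff γ α (n + 1))) *
      (q ^ n * sunWeight γ α q) := by
    intro n q
    simp only [hF]
    rw [← mul_neg q y, mul_pow]
    ring
  have hwc := sunWeight_continuousOn hγ hα0 hα1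
  have hFc : ∀ n, ContinuousOn (F n) (Icc 0 1) := fun n => hwc.mul (by fun_prop)
  have hint : ∀ n, IntegrableOn (F n) (Ioc 0 1) := fun n =>
    ((hFc n).integrableOn_compact isCompact_Icc).mono_set Ioc_subset_Icc_self
  have hval : ∀ n, ∫ q in Ioc (0 : ℝ) 1, F n q =
      1 / (1 - α) ^ γ * (-((-y) ^ n / (n.factorial : ℝ) * sunCoeff γ α (n + 1))) +
      (-y) ^ n / (n.factorial : ℝ) * sunCoeff γ α n := by
    intro n
    simp only [hFe]
    rw [← intervalIntegral.integral_of_le zero_le_one, intervalIntegral.integral_const_mul,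
      ← sunCoeff_succ_mul hγ hα0 hα1 n, sunFactor_succ hγ hα0 hα1,
      integral_pow_mul_sunProfile hγ hα0 hα1]
    ring
  set W := ∫ q in Ioc (0 : ℝ) 1, sunWeight γ α q with hW
  have hbound : ∀ n, ∫ q in Ioc (0 : ℝ) 1, ‖F n q‖ ≤ |y| ^ n / (n.factorial : ℝ) * W := by
    intro n
    rw [hW, ← integral_const_mul]
    refine setIntegral_mono_on (hint n).norm
      (((hwc.integrableOn_compact isCompact_Icc).mono_set Ioc_subset_Icc_self).const_mul _)
      measurableSet_Ioc fun q hq => ?_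
    have hw := sunWeight_nonneg hγ hα0 hα1 (Ioc_subset_Icc_self hq)
    simp only [hF]
    rw [norm_mul, norm_neg, Real.norm_of_nonneg hw, mul_comm]
    refine mul_le_mul_of_nonneg_right ?_ hw
    refine altExp_norm_term_le ha' ?_ n
    rw [abs_mul, abs_of_pos hq.1]
    exact mul_le_of_le_one_left (abs_nonneg _) hq.2
  have hS := hasSum_integral_of_summable_integral_norm hint
    (Summable.of_nonneg_of_le (fun n => integral_nonneg fun q => norm_nonneg _) hbound
      ((Real.summable_pow_div_factorial |y|).mul_right W))
  simp only [hval] at hS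
  have hpt : ∀ q, ∑' n, F n q =
      sunWeight γ α q * (-altExp (fun n => sunCoeff γ α (n + 1)) (q * y)) := fun q =>
    (((altExp_hasSum ha' (q * y)).neg).mul_left _).tsum_eq
  simp only [hpt] at hS
  rw [intervalIntegral.integral_of_le zero_le_one]
  exact ((((altExp_hasSum ha' y).neg).mul_left _).add (altExp_hasSum ha y)).unique hS

theorem sunGen_integrableOn : IntegrableOn (sunGen γ α) (Ioi 0) := by
  obtain ⟨w, hw, hi, hI⟩ := exists_sunWeight_exponent hγ hα0 hα1
  have ha := abs_sunCoeff_le hγ hα0 hα1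
  rw [sunGen_eq]
  exact integrableOn_of_pantograph (one_div_pos.2 (Real.rpow_pos_of_pos (sub_pos.2 hα1) γ)) hw
    (fun y => altExp_hasDerivAt ha y)
    (altExp_continuous (a := fun n => sunCoeff γ α (n + 1)) fun n => ha (n + 1)).neg
    (sunWeight_continuousOn hγ hα0 hα1) (fun q hq => sunWeight_nonneg hγ hα0 hα1 hq) hi rfl hI
    (fun y _ => sunGen_pantograph hγ hα0 hα1 y)

end Coeff

/-! ### The density in the variable `v = x^{-γ}` -/

/-- The integral equation in the variable `v = x^{-γ}`: a probability density `k` on `(0, ∞)` with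
`k(v) = ∫_v^∞ k(w) φ(v/w) dw`, where `φ` is `sunProfile`. -/
structure IsInvSunDensity (γ α : ℝ) (k : ℝ → ℝ) : Prop where
  nonneg : ∀ v, 0 < v → 0 ≤ k v
  integrable : IntegrableOn k (Ioi 0)
  integral_eq_one : ∫ v in Ioi (0 : ℝ), k v = 1
  equation : ∀ v, 0 < v → k v = ∫ w in Ioi v, k w * sunProfile γ α (v / w)

theorem sunProfile_measurable (γ α : ℝ) : Measurable (sunProfile γ α) := by
  unfold sunProfile
  fun_prop

theorem div_mem_Icc_of_lt {v w : ℝ} (hv : 0 < v) (hw : v < w) : v / w ∈ Icc (0 : ℝ) 1 :=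
  ⟨(div_pos hv (hv.trans hw)).le, (div_le_one (hv.trans hw)).2 hw.le⟩

namespace IsInvSunDensity

variable {γ α : ℝ} {k : ℝ → ℝ} (hk : IsInvSunDensity γ α k) (hγ : 0 < γ) (hα0 : 0 < α)
  (hα1 : α < 1)
include hk hγ hα0 hα1

theorem norm_kernel_le {v w : ℝ} (hv : 0 < v) (hw : v < w) :
    ‖k w * sunProfile γ α (v / w)‖ ≤ 1 / (1 - α) ^ γ * k w := by
  have hm := div_mem_Icc_of_lt hv hw
  have hk0 := hk.nonneg w (hv.trans hw)
  have h1 := one_le_sunProfile hγ hα0 hα1 hm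
  rw [Real.norm_of_nonneg (mul_nonneg hk0 (by linarith)), mul_comm]
  exact mul_le_mul_of_nonneg_right (sunProfile_le hγ hα0 hα1 hm) hk0

theorem integrableOn_kernel {v : ℝ} (hv : 0 < v) :
    IntegrableOn (fun w => k w * sunProfile γ α (v / w)) (Ioi v) := by
  have hki := hk.integrable.mono_set (Ioi_subset_Ioi hv.le)
  refine Integrable.mono' (hki.const_mul (1 / (1 - α) ^ γ)) (hki.aestronglyMeasurable.mul ?_)
    ((ae_restrict_mem measurableSet_Ioi).mono fun w hw => hk.norm_kernel_le hγ hα0 hα1 hv hw)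
  exact ((sunProfile_measurable γ α).comp (by fun_prop)).aestronglyMeasurable

theorem le_bound {v : ℝ} (hv : 0 < v) : |k v| ≤ 1 / (1 - α) ^ γ := by
  have hc : 0 < 1 / (1 - α) ^ γ := one_div_pos.2 (Real.rpow_pos_of_pos (sub_pos.2 hα1) γ)
  rw [abs_of_nonneg (hk.nonneg v hv), hk.equation v hv]
  calc ∫ w in Ioi v, k w * sunProfile γ α (v / w) ≤ ∫ w in Ioi v, 1 / (1 - α) ^ γ * k w :=
        setIntegral_mono_on (hk.integrableOn_kernel hγ hα0 hα1 hv)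
          ((hk.integrable.mono_set (Ioi_subset_Ioi hv.le)).const_mul _) measurableSet_Ioi
          fun w hw => (le_abs_self _).trans (hk.norm_kernel_le hγ hα0 hα1 hv hw)
    _ ≤ ∫ w in Ioi 0, 1 / (1 - α) ^ γ * k w := by
        refine setIntegral_mono_set (hk.integrable.const_mul _) ?_
          (Ioi_subset_Ioi hv.le).eventuallyLE
        exact (ae_restrict_mem measurableSet_Ioi).mono fun w hw =>
          mul_nonneg hc.le (hk.nonneg w hw)
    _ = 1 / (1 - α) ^ γ := by rw [integral_const_mul, hk.integral_eq_one, mul_one]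

/-- The kernel `φ(v/w)` is continuous up to the diagonal because `α < 1`, so `k` is continuous. -/
theorem continuousAt {v : ℝ} (hv : 0 < v) : ContinuousAt k v := by
  have hev : (fun v' => ∫ w in Ioi (0 : ℝ),
      (Ioi v').indicator (fun w => k w * sunProfile γ α (v' / w)) w) =ᶠ[nhds v] k := by
    filter_upwards [lt_mem_nhds hv] with v' hv'
    rw [setIntegral_indicator measurableSet_Ioi, Ioi_inter_Ioi, sup_eq_right.2 hv'.le,
      hk.equation v' hv']
  refine ContinuousAt.congr (f := fun v' => ∫ w in Ioi (0 : ℝ),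
      (Ioi v').indicator (fun w => k w * sunProfile γ α (v' / w)) w) ?_ hev
  refine continuousAt_of_dominated (bound := fun w => 1 / (1 - α) ^ γ * k w) ?_ ?_
    (hk.integrable.const_mul _) ?_
  · refine Filter.Eventually.of_forall fun v' => AEStronglyMeasurable.indicator ?_ measurableSet_Ioi
    refine hk.integrable.aestronglyMeasurable.mul ?_
    exact ((sunProfile_measurable γ α).comp (by fun_prop)).aestronglyMeasurable
  · filter_upwards [lt_mem_nhds hv] with v' hv'
    refine (ae_restrict_mem measurableSet_Ioi).mono fun w hw => ?_
    by_cases h : w ∈ Ioi v'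
    · rw [indicator_of_mem h]
      exact hk.norm_kernel_le hγ hα0 hα1 hv' h
    · rw [indicator_of_notMem h, norm_zero]
      exact mul_nonneg (one_div_nonneg.2 (Real.rpow_nonneg (sub_pos.2 hα1).le γ))
        (hk.nonneg w hw)
  · have hne : ∀ᵐ w ∂(volume.restrict (Ioi (0 : ℝ))), w ≠ v :=
      ae_restrict_of_ae (by simp [ae_iff, measure_singleton])
    filter_upwards [hne, ae_restrict_mem measurableSet_Ioi] with w hwv hw
    rcases lt_or_gt_of_ne hwv with h | h
    · refine (continuousAt_const (y := (0 : ℝ))).congr ?_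
      filter_upwards [lt_mem_nhds h] with v' hv'
      rw [indicator_of_notMem (by simpa using hv'.le)]
    · have hφ : ContinuousAt (fun v' => k w * sunProfile γ α (v' / w)) v := by
        have h1 : ContinuousAt (sunProfile γ α) (v / w) :=
          (sunProfile_continuousOn hγ hα0 hα1).continuousAt
            (Icc_mem_nhds (div_pos hv hw) ((div_lt_one hw).2 h))
        exact continuousAt_const.mul
          (ContinuousAt.comp (f := fun v' => v' / w) h1 (by fun_prop))
      refine hφ.congr ?_
      filter_upwards [gt_mem_nhds h] with v' hv'
      rw [indicator_of_mem (show w ∈ Ioi v' from hv')]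

omit hk in
theorem integral_pow_mul_sunProfile_pos (l : ℕ) :
    0 < ∫ q in (0 : ℝ)..1, q ^ l * sunProfile γ α q := by
  have h := one_le_sunFactor hγ hα0 hα1 (l + 1)
  rw [sunFactor_succ hγ hα0 hα1] at h
  by_contra hn
  have : ((l : ℝ) + 1) * ∫ q in (0 : ℝ)..1, q ^ l * sunProfile γ α q ≤ 0 :=
    mul_nonpos_of_nonneg_of_nonpos (by positivity) (not_lt.1 hn)
  linarith

/-- The moment recursion `∫ v^l k = (∫₀¹ q^l φ(q) dq) · ∫ w^{l+1} k`, by Tonelli. -/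
theorem moment_succ (l : ℕ) (hl : IntegrableOn (fun v => v ^ l * k v) (Ioi 0)) :
    IntegrableOn (fun w => w ^ (l + 1) * k w) (Ioi 0) ∧
      ∫ v in Ioi (0 : ℝ), v ^ l * k v =
        (∫ q in (0 : ℝ)..1, q ^ l * sunProfile γ α q) *
          ∫ w in Ioi (0 : ℝ), w ^ (l + 1) * k w := by
  set μ := ∫ q in (0 : ℝ)..1, q ^ l * sunProfile γ α q with hμ
  have hμ0 : 0 < μ := integral_pow_mul_sunProfile_pos hγ hα0 hα1 l
  set G : ℝ → ℝ → ℝ := fun v w =>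
    (Ioi v).indicator (fun w => v ^ l * (k w * sunProfile γ α (v / w))) w with hG
  have hG' : ∀ v w, G v w = (Iio w).indicator
      (fun v => v ^ l * (k w * sunProfile γ α (v / w))) v := by
    intro v w
    by_cases h : v < w
    · rw [hG]; simp [h]
    · rw [hG]; simp [h]
  have hGm : AEStronglyMeasurable G.uncurry
      ((volume.restrict (Ioi (0 : ℝ))).prod (volume.restrict (Ioi (0 : ℝ)))) := by
    have he : G.uncurry = {p : ℝ × ℝ | p.1 < p.2}.indicator
        (fun p => p.1 ^ l * (k p.2 * sunProfile γ α (p.1 / p.2))) := by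
      funext p
      by_cases h : p.1 < p.2
      · simp [Function.uncurry, hG, h]
      · simp [Function.uncurry, hG, h]
    rw [he]
    refine AEStronglyMeasurable.indicator ?_ (measurableSet_lt measurable_fst measurable_snd)
    refine AEStronglyMeasurable.mul (by fun_prop)
      (hk.integrable.aestronglyMeasurable.comp_snd.mul ?_)
    exact ((sunProfile_measurable γ α).comp (by fun_prop)).aestronglyMeasurable
  have hG0 : ∀ v ∈ Ioi (0 : ℝ), ∀ w, 0 ≤ G v w := by
    intro v hv w
    refine indicator_nonneg (fun w hw => ?_) w
    have := one_le_sunProfile hγ hα0 hα1 (div_mem_Icc_of_lt hv hw)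
    have := hk.nonneg w (lt_trans hv hw)
    have : (0 : ℝ) < v := hv
    positivity
  have hGv : ∀ v ∈ Ioi (0 : ℝ), IntegrableOn (G v) (Ioi 0) ∧
      ∫ w in Ioi (0 : ℝ), G v w = v ^ l * k v := by
    intro v hv
    constructor
    · have h := (hk.integrableOn_kernel hγ hα0 hα1 hv).const_mul (v ^ l)
      exact ((integrable_indicator_iff measurableSet_Ioi).2 h).integrableOn
    · rw [hG]
      simp only []
      rw [setIntegral_indicator measurableSet_Ioi, Ioi_inter_Ioi, sup_eq_right.2 (le_of_lt hv),
        integral_const_mul, ← hk.equation v hv]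
  have hGw : ∀ w ∈ Ioi (0 : ℝ), ∫ v in Ioi (0 : ℝ), G v w = μ * (w ^ (l + 1) * k w) := by
    intro w hw
    have hw' : (0 : ℝ) < w := hw
    simp only [hG']
    rw [setIntegral_indicator measurableSet_Iio, Ioi_inter_Iio, ← integral_Ioc_eq_integral_Ioo,
      ← intervalIntegral.integral_of_le hw'.le]
    have he : ∀ v, v ^ l * (k w * sunProfile γ α (v / w)) =
        (w ^ l * k w) * ((v / w) ^ l * sunProfile γ α (v / w)) := by
      intro v
      rw [div_pow]
      field_simp
    simp only [he]
    rw [intervalIntegral.integral_const_mul, intervalIntegral.integral_comp_div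
      (fun q => q ^ l * sunProfile γ α q) hw'.ne', zero_div, div_self hw'.ne', ← hμ, smul_eq_mul]
    ring
  have hGi : Integrable G.uncurry
      ((volume.restrict (Ioi (0 : ℝ))).prod (volume.restrict (Ioi (0 : ℝ)))) := by
    refine (integrable_prod_iff hGm).2
      ⟨(ae_restrict_mem measurableSet_Ioi).mono fun v hv => (hGv v hv).1, ?_⟩
    refine hl.congr ((ae_restrict_mem measurableSet_Ioi).mono fun v hv => ?_)
    change v ^ l * k v = ∫ w in Ioi (0 : ℝ), ‖G v w‖
    rw [← (hGv v hv).2]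
    exact integral_congr_ae (Filter.Eventually.of_forall fun w =>
      (Real.norm_of_nonneg (hG0 v hv w)).symm)
  have hri : IntegrableOn (fun w => μ * (w ^ (l + 1) * k w)) (Ioi 0) :=
    hGi.integral_prod_right.congr ((ae_restrict_mem measurableSet_Ioi).mono fun w hw => hGw w hw)
  refine ⟨?_, ?_⟩
  · have := hri.const_mul μ⁻¹
    refine this.congr (Filter.Eventually.of_forall fun w => ?_)
    simp only []
    rw [← mul_assoc, inv_mul_cancel₀ hμ0.ne', one_mul]
  · rw [← integral_const_mul, ← setIntegral_congr_fun measurableSet_Ioi hGw,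
      ← setIntegral_congr_fun measurableSet_Ioi fun v hv => (hGv v hv).2]
    exact integral_integral_swap hGi

theorem moment (l : ℕ) : IntegrableOn (fun v => v ^ l * k v) (Ioi 0) ∧
    ∫ v in Ioi (0 : ℝ), v ^ l * k v = (l.factorial : ℝ) * sunCoeff γ α l := by
  induction l with
  | zero => simpa [sunCoeff_zero] using ⟨hk.integrable, hk.integral_eq_one⟩
  | succ l ih =>
    obtain ⟨h1, h2⟩ := hk.moment_succ hγ hα0 hα1 l ih.1
    refine ⟨h1, ?_⟩
    have hμ := integral_pow_mul_sunProfile_pos hγ hα0 hα1 l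
    rw [ih.2, ← sunCoeff_succ_mul hγ hα0 hα1 l, sunFactor_succ hγ hα0 hα1] at h2
    rw [Nat.factorial_succ]
    push_cast
    refine mul_left_cancel₀ hμ.ne' ?_
    rw [← h2]
    ring

/-- `g` is the Hankel transform of `k`: integrate the Bessel series against the moments. -/
theorem sunGen_eq_integral (y : ℝ) :
    sunGen γ α y = ∫ v in Ioi (0 : ℝ), besselSq (y * v) * k v := by
  have ha := abs_sunCoeff_le hγ hα0 hα1
  set F : ℕ → ℝ → ℝ := fun n v => (-y) ^ n / (n.factorial : ℝ) ^ 2 * (v ^ n * k v) with hF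
  have hint : ∀ n, IntegrableOn (F n) (Ioi 0) := fun n => (hk.moment hγ hα0 hα1 n).1.const_mul _
  have hval : ∀ n, ∫ v in Ioi (0 : ℝ), F n v = (-y) ^ n / (n.factorial : ℝ) * sunCoeff γ α n := by
    intro n
    simp only [hF]
    rw [integral_const_mul, (hk.moment hγ hα0 hα1 n).2]
    field_simp
  have hnval : ∀ n, ∫ v in Ioi (0 : ℝ), ‖F n v‖ =
      |y| ^ n / (n.factorial : ℝ) * sunCoeff γ α n := by
    intro n
    have he : ∀ v ∈ Ioi (0 : ℝ), ‖F n v‖ = |y| ^ n / (n.factorial : ℝ) ^ 2 * (v ^ n * k v) := by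
      intro v hv
      have hv' : (0 : ℝ) < v := hv
      have := hk.nonneg v hv
      simp only [hF]
      rw [norm_mul, Real.norm_of_nonneg (show 0 ≤ v ^ n * k v by positivity), norm_div, norm_pow,
        norm_neg, Real.norm_eq_abs, Real.norm_of_nonneg (by positivity)]
    rw [setIntegral_congr_fun measurableSet_Ioi he, integral_const_mul,
      (hk.moment hγ hα0 hα1 n).2]
    field_simp
  have hS := hasSum_integral_of_summable_integral_norm hint (by
    simp only [hnval]
    refine Summable.of_nonneg_of_le (fun n => ?_) (fun n => ?_)
      (Real.summable_pow_div_factorial |y|)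
    · have := sunCoeff_pos hγ hα0 hα1 n
      positivity
    · exact mul_le_of_le_one_right (by positivity) ((le_abs_self _).trans (ha n)))
  simp only [hval] at hS
  have hpt : ∀ v, ∑' n, F n v = besselSq (y * v) * k v := by
    intro v
    rw [← (besselSq_hasSum (y * v)).tsum_eq, ← tsum_mul_right]
    refine tsum_congr fun n => ?_
    simp only [hF]
    rw [← neg_mul, mul_pow]
    ring
  simp only [hpt] at hS
  rw [sunGen_eq]
  exact (altExp_hasSum ha y).unique hS

omit hγ hα0 hα1 in
theorem integrableOn_besselSq_mul {y : ℝ} (hy : 0 ≤ y) :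
    IntegrableOn (fun v => besselSq (y * v) * k v) (Ioi 0) :=
  hk.integrable.bdd_mul (c := 1)
    (besselSq_continuous.comp (continuous_const.mul continuous_id)).aestronglyMeasurable
    ((ae_restrict_mem measurableSet_Ioi).mono fun _ hv =>
      abs_besselSq_le_one (mul_nonneg hy (le_of_lt hv)))

omit hk in
theorem integrableOn_besselSq_mul_sunGen {v : ℝ} (hv : 0 ≤ v) :
    IntegrableOn (fun y => besselSq (v * y) * sunGen γ α y) (Ioi 0) :=
  (sunGen_integrableOn hγ hα0 hα1).bdd_mul (c := 1)
    (besselSq_continuous.comp (continuous_const.mul continuous_id)).aestronglyMeasurable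
    ((ae_restrict_mem measurableSet_Ioi).mono fun _ hy =>
      abs_besselSq_le_one (mul_nonneg hv (le_of_lt hy)))

/-- Abel-regularised inversion: Fubini and Weber's integral turn the damped Hankel transform of `g`
into the Weber mean of `k`. -/
theorem integral_exp_mul_besselSq_mul_sunGen {ε v : ℝ} (hε : 0 < ε) (hv : 0 ≤ v) :
    ∫ y in Ioi (0 : ℝ), Real.exp (-(ε * y)) * (besselSq (v * y) * sunGen γ α y) =
      ∫ w in Ioi (0 : ℝ), weberKernel ε v w * k w := by
  set H : ℝ → ℝ → ℝ := fun y w =>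
    Real.exp (-(ε * y)) * besselSq (v * y) * besselSq (w * y) * k w with hH
  have hexp : IntegrableOn (fun y => Real.exp (-(ε * y))) (Ioi 0) := by
    simpa using (integral_pow_mul_exp_neg_mul 0 hε).1
  have hHi : Integrable H.uncurry
      ((volume.restrict (Ioi (0 : ℝ))).prod (volume.restrict (Ioi (0 : ℝ)))) := by
    refine Integrable.mono (hexp.mul_prod hk.integrable) ?_ ?_
    · have hc : Continuous fun p : ℝ × ℝ =>
          Real.exp (-(ε * p.1)) * besselSq (v * p.1) * besselSq (p.2 * p.1) := by
        have := besselSq_continuous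
        fun_prop
      exact hc.aestronglyMeasurable.mul hk.integrable.aestronglyMeasurable.comp_snd
    · rw [Measure.prod_restrict]
      refine (ae_restrict_mem (measurableSet_Ioi.prod measurableSet_Ioi)).mono fun p hp => ?_
      have h1 : ‖besselSq (v * p.1)‖ ≤ 1 := abs_besselSq_le_one (mul_nonneg hv (le_of_lt hp.1))
      have h2 : ‖besselSq (p.2 * p.1)‖ ≤ 1 :=
        abs_besselSq_le_one (mul_nonneg (le_of_lt hp.2) (le_of_lt hp.1))
      simp only [Function.uncurry, hH, norm_mul]
      refine mul_le_mul_of_nonneg_right ?_ (norm_nonneg _)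
      calc _ ≤ ‖Real.exp (-(ε * p.1))‖ * 1 * 1 := by gcongr
        _ = _ := by ring
  have hL : ∀ y ∈ Ioi (0 : ℝ), Real.exp (-(ε * y)) * (besselSq (v * y) * sunGen γ α y) =
      ∫ w in Ioi (0 : ℝ), H y w := by
    intro y _
    rw [hk.sunGen_eq_integral hγ hα0 hα1 y, ← mul_assoc, ← integral_const_mul]
    refine setIntegral_congr_fun measurableSet_Ioi fun w _ => ?_
    simp only [hH]
    rw [mul_comm y w]
    ring
  have hRr : ∀ w ∈ Ioi (0 : ℝ), weberKernel ε v w * k w = ∫ y in Ioi (0 : ℝ), H y w := by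
    intro w hw
    rw [← integral_exp_mul_besselSq_mul_besselSq hε hv (le_of_lt hw), ← integral_mul_const]
  rw [setIntegral_congr_fun measurableSet_Ioi hL, setIntegral_congr_fun measurableSet_Ioi hRr]
  exact integral_integral_swap hHi

theorem eq_integral_sunGen {v : ℝ} (hv : 0 < v) :
    k v = ∫ y in Ioi (0 : ℝ), besselSq (v * y) * sunGen γ α y := by
  have hi := integrableOn_besselSq_mul_sunGen hγ hα0 hα1 hv.le
  have h1 : Filter.Tendsto (fun ε => ∫ w in Ioi (0 : ℝ), weberKernel ε v w * k w)
      (nhdsWithin 0 (Ioi 0)) (nhds (k v)) :=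
    tendsto_integral_weberKernel hv (fun w hw => hk.le_bound hγ hα0 hα1 hw)
      hk.integrable.aestronglyMeasurable (hk.continuousAt hγ hα0 hα1 hv)
  have h2 : Filter.Tendsto (fun ε => ∫ y in Ioi (0 : ℝ),
      Real.exp (-(ε * y)) * (besselSq (v * y) * sunGen γ α y)) (nhdsWithin 0 (Ioi 0))
      (nhds (∫ y in Ioi (0 : ℝ), besselSq (v * y) * sunGen γ α y)) := by
    refine tendsto_integral_filter_of_dominated_convergence
      (fun y => ‖besselSq (v * y) * sunGen γ α y‖) ?_ ?_ hi.norm ?_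
    · exact Filter.Eventually.of_forall fun ε =>
        (by fun_prop : Continuous fun y : ℝ =>
          Real.exp (-(ε * y))).aestronglyMeasurable.mul hi.aestronglyMeasurable
    · filter_upwards [self_mem_nhdsWithin] with ε hε
      refine (ae_restrict_mem measurableSet_Ioi).mono fun y hy => ?_
      rw [norm_mul]
      refine mul_le_of_le_one_left (norm_nonneg _) ?_
      rw [Real.norm_of_nonneg (Real.exp_nonneg _), Real.exp_le_one_iff]
      exact neg_nonpos.2 (mul_nonneg (le_of_lt hε) (le_of_lt hy))
    · refine Filter.Eventually.of_forall fun y => ?_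
      have hc : Continuous fun ε : ℝ =>
          Real.exp (-(ε * y)) * (besselSq (v * y) * sunGen γ α y) := by fun_prop
      have := hc.tendsto 0
      simp only [zero_mul, neg_zero, Real.exp_zero, one_mul] at this
      exact this.mono_left nhdsWithin_le_nhds
  refine tendsto_nhds_unique h1 (h2.congr' ?_)
  filter_upwards [self_mem_nhdsWithin] with ε hε
  exact hk.integral_exp_mul_besselSq_mul_sunGen hγ hα0 hα1 hε hv.le

end IsInvSunDensity

/-! ### The change of variables `v = x^{-γ}` -/

/-- The density of `X^{-γ}` when `X` has density `h`. -/
noncomputable def invDensity (γ : ℝ) (h : ℝ → ℝ) (v : ℝ) : ℝ :=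
  1 / γ * v ^ (-1 / γ - 1) * h (v ^ (-1 / γ))

theorem rpow_neg_rpow_neg_one_div {γ x : ℝ} (hγ : 0 < γ) (hx : 0 < x) :
    (x ^ (-γ)) ^ (-1 / γ) = x := by
  rw [← Real.rpow_mul hx.le, show -γ * (-1 / γ) = 1 by field_simp, Real.rpow_one]

theorem invDensity_rpow_neg {γ x : ℝ} (hγ : 0 < γ) (h : ℝ → ℝ) (hx : 0 < x) :
    invDensity γ h (x ^ (-γ)) = 1 / γ * (x * x ^ γ) * h x := by
  rw [invDensity, Real.rpow_sub_one (Real.rpow_pos_of_pos hx _).ne',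
    rpow_neg_rpow_neg_one_div hγ hx, Real.rpow_neg hx.le, div_inv_eq_mul]

theorem eq_mul_invDensity {γ x : ℝ} (hγ : 0 < γ) (h : ℝ → ℝ) (hx : 0 < x) :
    h x = γ * x ^ (-γ - 1) * invDensity γ h (x ^ (-γ)) := by
  have := (Real.rpow_pos_of_pos hx γ).ne'
  rw [invDensity_rpow_neg hγ h hx, Real.rpow_sub_one hx.ne', Real.rpow_neg hx.le]
  field_simp

theorem rpow_comp_mul_eq {γ : ℝ} (hγ : 0 < γ) (h f : ℝ → ℝ) {x : ℝ} (hx : x ∈ Ioi (0 : ℝ)) :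
    (|-γ| * x ^ (-γ - 1)) • (f (x ^ (-γ)) * invDensity γ h (x ^ (-γ))) = f (x ^ (-γ)) * h x := by
  rw [eq_mul_invDensity hγ h hx, abs_neg, abs_of_pos hγ, smul_eq_mul]
  ring

theorem integral_rpow_comp_mul {γ : ℝ} (hγ : 0 < γ) (h f : ℝ → ℝ) :
    ∫ x in Ioi (0 : ℝ), f (x ^ (-γ)) * h x = ∫ v in Ioi (0 : ℝ), f v * invDensity γ h v := by
  rw [← integral_comp_rpow_Ioi (fun v => f v * invDensity γ h v) (neg_ne_zero.2 hγ.ne')]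
  exact (setIntegral_congr_fun measurableSet_Ioi fun x hx => rpow_comp_mul_eq hγ h f hx).symm

theorem integrableOn_rpow_comp_mul {γ : ℝ} (hγ : 0 < γ) (h f : ℝ → ℝ) :
    IntegrableOn (fun x => f (x ^ (-γ)) * h x) (Ioi 0) ↔
      IntegrableOn (fun v => f v * invDensity γ h v) (Ioi 0) := by
  rw [← integrableOn_Ioi_comp_rpow_iff (fun v => f v * invDensity γ h v) (neg_ne_zero.2 hγ.ne')]
  exact integrableOn_congr_fun (fun x hx => (rpow_comp_mul_eq hγ h f hx).symm) measurableSet_Ioi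

theorem sunProfile_rpow_div {γ α x u : ℝ} (hγ : 0 < γ) (hα1 : α < 1) (hu : 0 < u)
    (hux : u < x) : sunProfile γ α (x ^ (-γ) / u ^ (-γ)) = x ^ γ / (x - α * u) ^ γ := by
  have hx : 0 < x := hu.trans hux
  have h1 : 0 < x - α * u := by nlinarith
  have h2 : x ^ (-γ) / u ^ (-γ) = (u / x) ^ γ := by
    rw [Real.rpow_neg hx.le, Real.rpow_neg hu.le, Real.div_rpow hu.le hx.le]
    field_simp
  rw [sunProfile, h2, ← Real.rpow_mul (div_pos hu hx).le, mul_one_div_cancel hγ.ne',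
    Real.rpow_one, show 1 - α * (u / x) = (x - α * u) / x by field_simp,
    Real.div_rpow h1.le hx.le, one_div_div]

theorem IsSunDensity.invDensity {γ α : ℝ} (hγ : 0 < γ) (hα1 : α < 1)
    {h : ℝ → ℝ} (hh : IsSunDensity γ α h) : IsInvSunDensity γ α (invDensity γ h) where
  nonneg v hv := by
    have := hh.nonneg _ (Real.rpow_pos_of_pos hv (-1 / γ))
    unfold _root_.invDensity
    positivity
  integrable := by
    have h1 := (integrableOn_rpow_comp_mul hγ h fun _ => 1).1
    simp only [one_mul] at h1
    exact h1 hh.integrable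
  integral_eq_one := by
    have h1 := integral_rpow_comp_mul hγ h fun _ => 1
    simp only [one_mul] at h1
    rw [← h1, hh.integral_eq_one]
  equation v hv := by
    obtain ⟨x, hx, rfl⟩ : ∃ x : ℝ, 0 < x ∧ x ^ (-γ) = v :=
      ⟨v ^ (-1 / γ), Real.rpow_pos_of_pos hv _, by
        rw [← Real.rpow_mul hv.le, show -1 / γ * -γ = 1 by field_simp, Real.rpow_one]⟩
    set f : ℝ → ℝ := (Ioi (x ^ (-γ))).indicator fun w => sunProfile γ α (x ^ (-γ) / w) with hf
    have h1 : ∫ w in Ioi (x ^ (-γ)), _root_.invDensity γ h w * sunProfile γ α (x ^ (-γ) / w) =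
        ∫ w in Ioi (0 : ℝ), f w * _root_.invDensity γ h w := by
      have he : (fun w => f w * _root_.invDensity γ h w) = (Ioi (x ^ (-γ))).indicator
          fun w => _root_.invDensity γ h w * sunProfile γ α (x ^ (-γ) / w) := by
        funext w
        by_cases hw : w ∈ Ioi (x ^ (-γ))
        · rw [hf, indicator_of_mem hw, indicator_of_mem hw, mul_comm]
        · rw [hf, indicator_of_notMem hw, indicator_of_notMem hw, zero_mul]
      rw [he, setIntegral_indicator measurableSet_Ioi, Ioi_inter_Ioi, sup_eq_right.2 hv.le]
    have h2 : ∀ u ∈ Ioi (0 : ℝ), f (u ^ (-γ)) * h u =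
        (Iio x).indicator (fun u => x ^ γ * (h u / (x - α * u) ^ γ)) u := by
      intro u hu
      by_cases hux : u < x
      · rw [hf, indicator_of_mem (show u ^ (-γ) ∈ Ioi (x ^ (-γ)) from
          Real.rpow_lt_rpow_of_neg hu hux (neg_neg_of_pos hγ)),
          indicator_of_mem (show u ∈ Iio x from hux), sunProfile_rpow_div hγ hα1 hu hux]
        ring
      · have hle : u ^ (-γ) ≤ x ^ (-γ) :=
          Real.rpow_le_rpow_of_nonpos hx (not_lt.1 hux) (neg_nonpos.2 hγ.le)
        rw [hf, indicator_of_notMem (show u ^ (-γ) ∉ Ioi (x ^ (-γ)) from not_lt.2 hle),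
          indicator_of_notMem (show u ∉ Iio x from hux), zero_mul]
    rw [h1, ← integral_rpow_comp_mul hγ h f, setIntegral_congr_fun measurableSet_Ioi h2,
      setIntegral_indicator measurableSet_Iio, Ioi_inter_Iio, ← integral_Ioc_eq_integral_Ioo,
      ← intervalIntegral.integral_of_le hx.le, intervalIntegral.integral_const_mul,
      invDensity_rpow_neg hγ h hx, hh.equation x hx]
    field_simp

theorem besselJZero_two_mul_rpow {γ a b : ℝ} (ha : 0 < a) (hb : 0 < b) :
    besselJZero (2 * (a * b) ^ (-γ / 2)) = besselSq (a ^ (-γ) * b ^ (-γ)) := by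
  rw [besselJZero_two_mul, ← Real.rpow_natCast, ← Real.rpow_mul (mul_pos ha hb).le,
    ← Real.mul_rpow ha.le hb.le]
  congr 2
  push_cast
  ring

/-! ### The Hankel transform pair -/

theorem mainTheorem8 (γ α : ℝ) (hγ : 0 < γ) (hα0 : 0 < α) (hα1 : α < 1)
    (h : ℝ → ℝ) (hh : IsSunDensity γ α h) :
    (∀ x : ℝ, 0 < x →
      IntegrableOn (fun t : ℝ => t ^ (-γ - 1) * besselJZero (2 * (x * t) ^ (-γ / 2)) *
        sunGen γ α (t ^ (-γ))) (Ioi 0) ∧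
      h x = γ ^ 2 * x ^ (-γ - 1) *
        ∫ t in Ioi (0 : ℝ), t ^ (-γ - 1) * besselJZero (2 * (x * t) ^ (-γ / 2)) *
          sunGen γ α (t ^ (-γ))) ∧
    (∀ t : ℝ, 0 < t →
      IntegrableOn (fun x : ℝ => besselJZero (2 * (t * x) ^ (-γ / 2)) * h x) (Ioi 0) ∧
      sunGen γ α (t ^ (-γ)) =
        ∫ x in Ioi (0 : ℝ), besselJZero (2 * (t * x) ^ (-γ / 2)) * h x) := by
  have hk := hh.invDensity hγ hα1
  have hγ' : -γ ≠ 0 := neg_ne_zero.2 hγ.ne'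
  refine ⟨fun x hx => ?_, fun t ht => ?_⟩
  · have hv : 0 < x ^ (-γ) := Real.rpow_pos_of_pos hx _
    set f : ℝ → ℝ := fun y => besselSq (x ^ (-γ) * y) * sunGen γ α y with hf
    have he : ∀ t ∈ Ioi (0 : ℝ), t ^ (-γ - 1) * besselJZero (2 * (x * t) ^ (-γ / 2)) *
        sunGen γ α (t ^ (-γ)) = t ^ (-γ - 1) • f (t ^ (-γ)) := by
      intro t ht
      rw [besselJZero_two_mul_rpow hx ht, smul_eq_mul, mul_assoc]
    have hint := IsInvSunDensity.integrableOn_besselSq_mul_sunGen hγ hα0 hα1 hv.le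
    refine ⟨(integrableOn_congr_fun he measurableSet_Ioi).2
      ((integrableOn_Ioi_comp_rpow_iff' f hγ').2 hint), ?_⟩
    have hsub : ∫ y in Ioi (0 : ℝ), f y = γ * ∫ t in Ioi (0 : ℝ), t ^ (-γ - 1) • f (t ^ (-γ)) := by
      rw [← integral_comp_rpow_Ioi f hγ', ← integral_const_mul]
      refine setIntegral_congr_fun measurableSet_Ioi fun t _ => ?_
      simp only [abs_neg, abs_of_pos hγ, smul_eq_mul]
      ring
    rw [setIntegral_congr_fun measurableSet_Ioi he, eq_mul_invDensity hγ h hx,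
      hk.eq_integral_sunGen hγ hα0 hα1 hv, hsub]
    ring
  · have hy : 0 < t ^ (-γ) := Real.rpow_pos_of_pos ht _
    have he : ∀ x ∈ Ioi (0 : ℝ), besselJZero (2 * (t * x) ^ (-γ / 2)) * h x =
        besselSq (t ^ (-γ) * x ^ (-γ)) * h x := by
      intro x hx
      rw [besselJZero_two_mul_rpow ht hx]
    refine ⟨(integrableOn_congr_fun he measurableSet_Ioi).2 ?_, ?_⟩
    · exact (integrableOn_rpow_comp_mul hγ h fun v => besselSq (t ^ (-γ) * v)).2
        (hk.integrableOn_besselSq_mul hy.le)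
    · rw [setIntegral_congr_fun measurableSet_Ioi he, hk.sunGen_eq_integral hγ hα0 hα1]
      exact (integral_rpow_comp_mul hγ h fun v => besselSq (t ^ (-γ) * v)).symm
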